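/- Let $0<\lambda<\tfrac12$ and $d>0$. A convex body in $\mathbb R^m$ is a compact convex set $K$ with $0$ in its interior; it is centrally symmetric if $K=-K$. For $x\in K$ put $K^x=\{x+y:\ y\in\mathbb R^m,\ \langle y,z-x\rangle\le 1\ \ \forall z\in K\}$, and define $$S(K,d)=\{x\in K:\ \mathrm{Vol}(K)\,\mathrm{Vol}(K^x)\le d\,\mathrm{Vol}(B_2^m)^2\},\qquad F(K,\lambda)=\bigcap_{\theta\in S^{m-1}}\{x:\langle x,\theta\rangle\le a_K(\theta)\},$$ where $B_2^m$ is the Euclidean unit ball and $a_K(\theta)\in\mathbb R$ is determined by $\mathrm{Vol}(K\cap\{\langle x,\theta\rangle\ge a_K(\theta)\})=\lambda\,\mathrm{Vol}(K)$. A function $f:\mathbb R^n\to[0,\infty)$ is log-concave if $f(x)^{p}f(y)^{1-p}\le f(px+(1-p)y)$ for all $x,y\in\mathbb R^n$ and $0<p<1$, and even if $f(-x)=f(x)$. Put $f_a(x)=f(x-a)$ and $f^\circ(x)=\inf_{y\in\mathbb R^n}e^{-\langle x,y\rangle}/f(y)$ (the quotient being $+\infty$ where $f(y)=0$). For log-concave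 $f$ with $0<\int f<\infty$ define $$S(f,d)=\Big\{a\in\mathbb R^n:\ \int f_a\int (f_a)^\circ\le(2\pi)^n d\Big\},\qquad F(f,\lambda)=\bigcap_{\theta\in S^{n-1}}\{x:\langle x,\theta\rangle\le a_f(\theta)\},$$ where $a_f(\theta)\in\mathbb R$ is determined by $\int_{\{\langle x,\theta\rangle\ge a_f(\theta)\}}f\,dx=\lambda\int f\,dx$. Suppose that $F(K,\lambda)\subseteq S(K,d)$ for every $m$ and every centrally symmetric convex body $K\subset\mathbb R^m$. Then, for every $n$, $F(f,\lambda)\subseteq S(f,d)$ for every even log-concave function $f:\mathbb R^n\to[0,\infty)$ with $0<\int f<\infty$. -/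

import Mathlib

open MeasureTheory
open scoped NNReal ENNReal

noncomputable section

namespace FloatingSantalo

/-- Euclidean space `ℝⁿ`, with its standard scalar product and Lebesgue measure. -/
abbrev E (n : ℕ) : Type := EuclideanSpace ℝ (Fin n)

/-- The half-space `H⁺ = {x : ⟨x, θ⟩ ≥ a}`. -/
def upperHalfSpace {n : ℕ} (θ : E n) (a : ℝ) : Set (E n) := {x | a ≤ inner ℝ x θ}

/-- The half-space `H⁻ = {x : ⟨x, θ⟩ ≤ a}`. -/
def lowerHalfSpace {n : ℕ} (θ : E n) (a : ℝ) : Set (E n) := {x | inner ℝ x θ ≤ a}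

/-! ### Convex bodies -/

/-- A convex body: a compact convex set with `0` in its interior. -/
structure IsConvexBody {n : ℕ} (K : Set (E n)) : Prop where
  isCompact : IsCompact K
  convex : Convex ℝ K
  zero_mem_interior : (0 : E n) ∈ interior K

/-- Central symmetry: `K = -K`. -/
def IsCentrallySymmetric {n : ℕ} (K : Set (E n)) : Prop := ∀ x, x ∈ K ↔ -x ∈ K

/-- The polar `K^x = x + (K - x)°` of `K` with respect to the point `x`. -/
def polarAt {n : ℕ} (K : Set (E n)) (x : E n) : Set (E n) :=
  {w | ∃ y : E n, w = x + y ∧ ∀ z ∈ K, inner ℝ y (z - x) ≤ 1}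

/-- The Santaló region `S(K, t) = {x ∈ K : Vol(K) Vol(K^x) ≤ t Vol(B₂ⁿ)²}`. -/
def bodySantaloRegion {n : ℕ} (K : Set (E n)) (t : ℝ) : Set (E n) :=
  {x | x ∈ K ∧ volume K * volume (polarAt K x) ≤
    ENNReal.ofReal t * volume (Metric.closedBall (0 : E n) 1) ^ 2}

/-- The floating body `F(K, l)`: the intersection, over unit vectors `θ`, of the half-spaces
`{⟨x, θ⟩ ≤ a}` such that `{⟨x, θ⟩ ≥ a}` cuts off the volume `l Vol(K)` from `K`. -/
def bodyFloatingBody {n : ℕ} (K : Set (E n)) (l : ℝ) : Set (E n) :=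
  {x | ∀ θ : E n, ‖θ‖ = 1 → ∀ a : ℝ,
    volume (upperHalfSpace θ a ∩ K) = ENNReal.ofReal l * volume K → x ∈ lowerHalfSpace θ a}

/-! ### Log-concave functions -/

/-- Log-concavity of `f : ℝⁿ → [0, ∞)`, in multiplicative form, which is the inequality
`p log f(x) + q log f(y) ≤ log f(p x + q y)` with `log 0 = -∞`. -/
def IsLogConcave {n : ℕ} (f : E n → ℝ≥0) : Prop :=
  ∀ x y : E n, ∀ p q : ℝ, 0 < p → 0 < q → p + q = 1 →
    f x ^ p * f y ^ q ≤ f (p • x + q • y)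

/-- The integral `∫ f` over `ℝⁿ`, as an element of `[0, ∞]`. -/
def funIntegral {n : ℕ} (f : E n → ℝ≥0) : ℝ≥0∞ := ∫⁻ x, (f x : ℝ≥0∞)

/-- The translate `f_a(x) = f(x - a)`. -/
def funTranslate {n : ℕ} (f : E n → ℝ≥0) (a : E n) : E n → ℝ≥0 := fun x => f (x - a)

/-- The functional polar `f°(x) = inf_y e^{-⟨x, y⟩} / f(y)`, where the quotient is `+∞` at the
points with `f(y) = 0`. -/
def functionPolar {n : ℕ} (f : E n → ℝ≥0) (x : E n) : ℝ≥0∞ :=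
  ⨅ y : E n, ENNReal.ofReal (Real.exp (-inner ℝ x y)) / (f y : ℝ≥0∞)

/-- The Santaló region `S(f, t) = {a : ∫ f_a ∫ (f_a)° ≤ (2π)ⁿ t}`. -/
def funSantaloRegion {n : ℕ} (f : E n → ℝ≥0) (t : ℝ) : Set (E n) :=
  {a | funIntegral (funTranslate f a) * ∫⁻ x, functionPolar (funTranslate f a) x ≤
    ENNReal.ofReal ((2 * Real.pi) ^ n * t)}

/-- The floating body `F(f, l)`: the intersection, over unit vectors `θ`, of the half-spaces
`{⟨x, θ⟩ ≤ a}` such that the integral of `f` over `{⟨x, θ⟩ ≥ a}` is `l ∫ f`. -/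
def funFloatingBody {n : ℕ} (f : E n → ℝ≥0) (l : ℝ) : Set (E n) :=
  {x | ∀ θ : E n, ‖θ‖ = 1 → ∀ a : ℝ,
    ∫⁻ z in upperHalfSpace θ a, (f z : ℝ≥0∞) = ENNReal.ofReal l * funIntegral f →
      x ∈ lowerHalfSpace θ a}

end FloatingSantalo

end

/-!
Let `f` be an even log-concave function with maximum `f 0`, and write `f = f 0 * exp ψ` on a
bounded symmetric convex set `C` on which `ψ ≤ 0` is bounded. The hypothesis on convex bodies is
applied to the closure of the body `{(x, y) : x ∈ C, |y| ≤ 1 + ψ(x) / s}` in `ℝⁿ × ℝˢ`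
(`bodyOver`). By Fubini, its volume is `κ_s ∫_C (1 + ψ / s) ^ s`, which is close to
`κ_s ∫_C exp ψ`, where `κ_s` is the volume of the unit ball of `ℝˢ`. In the same way the volume of
its polar with respect to `(b, 0)` is at least about `s⁻ⁿ κ_s` times the integral of the polar of
the translated function (`polar_bodyOver_of_pow_lt`, `volume_pow_lt_comp_smul`). Since
`sⁿ κ_{n+s}² ≤ (2π)ⁿ κ_s²` (`pow_mul_volume_closedBall_sq_le`), the inequality for bodies turns into
the inequality for `exp ψ` as `s → ∞` (`lintegral_exp_mul_lintegral_le`).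

It has to be known that `(b, 0)` lies in the floating body, for `b = t • a` with `a` in the
floating body of `f` and `0 < t < 1`. Two consequences of the Prékopa–Leindler inequality
(`prekopaLeindler_real`, `LogConcave.lintegral_euclidean`), which is proved below, are used.

* The integral of `f` over the half-spaces `{c ≤ ⟨x, θ⟩}` is log-concave in `c`. It is at least
  `∫ f / 2` at `c = 0` and at least `l ∫ f` at `c = ⟨a, θ⟩`, so at `c = ⟨t • a, θ⟩` it exceeds
  `l ∫ f`, uniformly in `θ` (`le_lintegral_upperHalfSpace_smul`). The uniform gap absorbs the errors
  made by restricting `f` to `C` and by replacing `exp ψ` by `(1 + ψ / s) ^ s`.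
* Directions `(θ, η)` with `η ≠ 0` need not be considered: the section of the body over `y` is a
  symmetric convex set, which has more volume in the slab `c - w ≤ ⟨x, θ⟩ ≤ c` than in the slab
  `c ≤ ⟨x, θ⟩ ≤ c + w`. Summing over the sections at `y` and `-y` shows that tilting a half-space in
  the direction `η` increases the volume that it cuts off (`volume_inter_upperHalfSpace_le_tilt`).

Finally the truncation is removed by monotone convergence, and `t → 1` by Fatou's lemma.
-/

namespace FloatingSantalo

open Set Filter Topology Pointwise

/-! ### The Prékopa–Leindler inequality -/

/-- The Brunn–Minkowski inequality for compact subsets of the line: the translates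
`K + min L` and `max K + L` overlap in one point. -/
theorem volume_add_volume_le_of_isCompact {K L S : Set ℝ} (hK : IsCompact K) (hL : IsCompact L)
    (hK' : K.Nonempty) (hL' : L.Nonempty) (hS : K + L ⊆ S) :
    volume K + volume L ≤ volume S := by
  obtain ⟨M, hM, hMK⟩ := hK.exists_isGreatest hK'
  obtain ⟨m, hm, hmL⟩ := hL.exists_isLeast hL'
  have h1 : volume ((fun x => x + m) '' K) = volume K := by
    rw [image_add_right, measure_preimage_add_right]
  have h2 : volume ((fun x => M + x) '' L) = volume L := by
    rw [image_add_left, measure_preimage_add]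
  have hd : AEDisjoint volume ((fun x => x + m) '' K) ((fun x => M + x) '' L) := by
    refine measure_mono_null (t := {M + m}) ?_ (by simp)
    rintro z ⟨⟨x, hx, rfl⟩, ⟨y, hy, hxy⟩⟩
    have := hMK hx
    have := hmL hy
    simp only [mem_singleton_iff]
    simp only at hxy
    linarith
  rw [← h1, ← h2, ← measure_union₀
    ((hL.image (by fun_prop)).measurableSet.nullMeasurableSet) hd]
  refine measure_mono ((union_subset ?_ ?_).trans hS)
  · rintro _ ⟨x, hx, rfl⟩
    exact add_mem_add hx hm
  · rintro _ ⟨x, hx, rfl⟩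
    exact add_mem_add hM hx

/-- The Brunn–Minkowski inequality on the line. -/
theorem volume_add_volume_le {A B S : Set ℝ} (hA : MeasurableSet A) (hB : MeasurableSet B)
    (hA' : A.Nonempty) (hB' : B.Nonempty) (hS : A + B ⊆ S) :
    volume A + volume B ≤ volume S := by
  obtain ⟨a, ha⟩ := hA'
  obtain ⟨b, hb⟩ := hB'
  have key : ∀ K ⊆ A, IsCompact K → ∀ L ⊆ B, IsCompact L → volume K + volume L ≤ volume S := by
    intro K hKA hK L hLB hL
    -- Adding a point makes the compact sets nonempty.
    have hKA' : insert a K ⊆ A := insert_subset ha hKA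
    have hLB' : insert b L ⊆ B := insert_subset hb hLB
    exact (add_le_add (measure_mono (subset_insert a K)) (measure_mono (subset_insert b L))).trans
      (volume_add_volume_le_of_isCompact (hK.insert a) (hL.insert b) ⟨a, by simp⟩ ⟨b, by simp⟩
        ((add_subset_add hKA' hLB').trans hS))
  refine ENNReal.le_of_forall_nnreal_lt fun r hr => ?_
  obtain ⟨s, t, hs, ht, hst⟩ : ∃ s t : ℝ≥0∞, (s < volume A ∨ s = 0) ∧ (t < volume B ∨ t = 0) ∧
      (r : ℝ≥0∞) ≤ s + t := by
    rcases eq_or_ne (volume A) 0 with h0 | h0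
    · exact ⟨0, r, Or.inr rfl, Or.inl (by simpa [h0] using hr), by simp⟩
    rcases eq_or_ne (volume B) 0 with h0' | h0'
    · exact ⟨r, 0, Or.inl (by simpa [h0'] using hr), Or.inr rfl, by simp⟩
    · obtain ⟨s, hs, t, ht, hst⟩ := ENNReal.exists_lt_add_of_lt_add hr h0 h0'
      exact ⟨s, t, Or.inl hs, Or.inl ht, hst.le⟩
  have hex : ∀ {A : Set ℝ} (_ : MeasurableSet A) {s : ℝ≥0∞}, (s < volume A ∨ s = 0) →
      ∃ K ⊆ A, IsCompact K ∧ s ≤ volume K := by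
    rintro A hA s (hs | rfl)
    · obtain ⟨K, hK, hK', h⟩ := hA.exists_lt_isCompact hs
      exact ⟨K, hK, hK', h.le⟩
    · exact ⟨∅, empty_subset _, isCompact_empty, zero_le⟩
  obtain ⟨K, hKA, hK, hsK⟩ := hex hA hs
  obtain ⟨L, hLB, hL, htL⟩ := hex hB ht
  exact hst.trans ((add_le_add hsK htL).trans (key K hKA hK L hLB hL))

/-- The layer-cake formula for a function truncated at height `c`, with the heights rescaled to
the unit interval. -/
theorem lintegral_min_eq_mul_lintegral_measure_lt {α : Type*} [MeasurableSpace α] {μ : Measure α}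
    {g : α → ℝ≥0∞} (hg : AEMeasurable g μ) {c : ℝ≥0∞} (hc0 : c ≠ 0) (hc : c ≠ ∞) :
    ∫⁻ x, min (g x) c ∂μ = c * ∫⁻ t in Ioo (0 : ℝ) 1, μ {x | ENNReal.ofReal t * c < g x} := by
  have hfin : ∀ x, min (g x) c / c ≤ 1 := fun x => ENNReal.div_le_of_le_mul (by simp)
  have hfin' : ∀ x, min (g x) c / c ≠ ∞ := fun x => ((hfin x).trans_lt ENNReal.one_lt_top).ne
  have hm : AEMeasurable (fun x => min (g x) c / c) μ :=
    (hg.min aemeasurable_const).div_const c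
  have h1 := lintegral_eq_lintegral_meas_lt (f := fun x => (min (g x) c / c).toReal) μ
    (Eventually.of_forall fun x => ENNReal.toReal_nonneg) hm.ennreal_toReal
  have h2 : ∫⁻ t in Ioi (0 : ℝ), μ {a | t < (min (g a) c / c).toReal}
      = ∫⁻ t in Ioo (0 : ℝ) 1, μ {x | ENNReal.ofReal t * c < g x} := by
    rw [← lintegral_indicator measurableSet_Ioi, ← lintegral_indicator measurableSet_Ioo]
    congr 1 with t
    by_cases ht0 : 0 < t
    · by_cases ht1 : t < 1
      · rw [indicator_of_mem (by exact ht0), indicator_of_mem (by exact ⟨ht0, ht1⟩)]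
        congr 1 with x
        rw [mem_ofPred_eq, mem_ofPred_eq, ← ENNReal.ofReal_lt_iff_lt_toReal ht0.le (hfin' x),
          ENNReal.lt_div_iff_mul_lt (Or.inl hc0) (Or.inl hc), lt_min_iff]
        refine and_iff_left ?_
        calc ENNReal.ofReal t * c < 1 * c := by
              refine ENNReal.mul_lt_mul_left hc0 hc ?_
              simpa using ht1
          _ = c := one_mul c
      · rw [indicator_of_mem (by exact ht0), indicator_of_notMem (by simp [ht1])]
        convert! measure_empty (μ := μ)
        ext x
        simp only [mem_ofPred_eq, mem_empty_iff_false, iff_false, not_lt]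
        exact (ENNReal.toReal_le_of_le_ofReal zero_le_one (by simpa using hfin x)).trans
          (not_lt.1 ht1)
    · rw [indicator_of_notMem (by exact ht0), indicator_of_notMem (by simp [ht0])]
  rw [← h2, ← h1, ← lintegral_const_mul' _ _ hc]
  refine lintegral_congr fun x => ?_
  rw [ENNReal.ofReal_toReal (hfin' x), ENNReal.mul_div_cancel hc0 hc]

theorem ennreal_rpow_mul_rpow_le_add {p q : ℝ} (hp : 0 < p) (hq : 0 < q) (hpq : p + q = 1)
    (a b : ℝ≥0∞) : a ^ p * b ^ q ≤ ENNReal.ofReal p * a + ENNReal.ofReal q * b := by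
  rcases eq_or_ne a ∞ with rfl | ha
  · simp [hp]
  rcases eq_or_ne b ∞ with rfl | hb
  · simp [hq]
  lift a to ℝ≥0 using ha
  lift b to ℝ≥0 using hb
  have := NNReal.geom_mean_le_arith_mean2_weighted p.toNNReal q.toNNReal a b
    (by rw [← Real.toNNReal_add hp.le hq.le, hpq, Real.toNNReal_one])
  rw [Real.coe_toNNReal _ hp.le, Real.coe_toNNReal _ hq.le] at this
  rw [← ENNReal.coe_rpow_of_nonneg _ hp.le, ← ENNReal.coe_rpow_of_nonneg _ hq.le]
  simpa [ENNReal.ofReal] using ENNReal.coe_le_coe.2 this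

/-- The Prékopa–Leindler inequality on the line for functions with finite, nonzero suprema: after
the suprema are normalized to `1`, the superlevel sets satisfy the Brunn–Minkowski inequality. -/
theorem prekopaLeindler_real_of_iSup_ne_top {f g h : ℝ → ℝ≥0∞} (hf : Measurable f)
    (hg : Measurable g) (hh : Measurable h) {p q : ℝ} (hp : 0 < p) (hq : 0 < q) (hpq : p + q = 1)
    (H : ∀ x y, f x ^ p * g y ^ q ≤ h (p * x + q * y))
    (hf0 : ⨆ x, f x ≠ 0) (hft : ⨆ x, f x ≠ ∞) (hg0 : ⨆ x, g x ≠ 0) (hgt : ⨆ x, g x ≠ ∞) :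
    (∫⁻ x, f x) ^ p * (∫⁻ x, g x) ^ q ≤ ∫⁻ x, h x := by
  set a := ⨆ x, f x with ha
  set b := ⨆ x, g x with hb
  have hap0 : a ^ p ≠ 0 := by simp [hf0, hft]
  have hapt : a ^ p ≠ ∞ := by simp [hf0, hft]
  have hbq0 : b ^ q ≠ 0 := by simp [hg0, hgt]
  have hbqt : b ^ q ≠ ∞ := by simp [hg0, hgt]
  have hc0 : a ^ p * b ^ q ≠ 0 := mul_ne_zero hap0 hbq0
  have hct : a ^ p * b ^ q ≠ ∞ := ENNReal.mul_ne_top hapt hbqt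
  set I : ℝ≥0∞ := ∫⁻ t in Ioo (0 : ℝ) 1, volume {x | ENNReal.ofReal t * a < f x} with hI
  set J : ℝ≥0∞ := ∫⁻ t in Ioo (0 : ℝ) 1, volume {x | ENNReal.ofReal t * b < g x} with hJ
  have hfI : ∫⁻ x, f x = a * I := by
    rw [hI, ← lintegral_min_eq_mul_lintegral_measure_lt hf.aemeasurable hf0 hft]
    exact lintegral_congr fun x => (min_eq_left (le_iSup f x)).symm
  have hgJ : ∫⁻ x, g x = b * J := by
    rw [hJ, ← lintegral_min_eq_mul_lintegral_measure_lt hg.aemeasurable hg0 hgt]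
    exact lintegral_congr fun x => (min_eq_left (le_iSup g x)).symm
  have hmain : ∀ t ∈ Ioo (0 : ℝ) 1,
      ENNReal.ofReal p * volume {x | ENNReal.ofReal t * a < f x} +
        ENNReal.ofReal q * volume {x | ENNReal.ofReal t * b < g x} ≤
      volume {x | ENNReal.ofReal t * (a ^ p * b ^ q) < h x} := by
    rintro t ⟨ht0, ht1⟩
    have hlt : ∀ c : ℝ≥0∞, c ≠ 0 → c ≠ ∞ → ENNReal.ofReal t * c < c := by
      intro c h0 h1
      calc ENNReal.ofReal t * c < 1 * c := by
            refine ENNReal.mul_lt_mul_left h0 h1 ?_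
            simpa using ht1
        _ = c := one_mul c
    obtain ⟨x0, hx0⟩ := lt_iSup_iff.1 (hlt a hf0 hft)
    obtain ⟨y0, hy0⟩ := lt_iSup_iff.1 (hlt b hg0 hgt)
    have hvol : ∀ (r : ℝ) (_ : 0 < r) (A : Set ℝ),
        volume (r • A) = ENNReal.ofReal r * volume A := by
      intro r hr A
      rw [Measure.addHaar_smul]
      simp [abs_of_pos hr]
    rw [← hvol p hp, ← hvol q hq]
    refine volume_add_volume_le ((measurableSet_lt measurable_const hf).const_smul₀ p)
      ((measurableSet_lt measurable_const hg).const_smul₀ q)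
      ⟨p • x0, smul_mem_smul_set hx0⟩ ⟨q • y0, smul_mem_smul_set hy0⟩ ?_
    rintro _ ⟨_, ⟨x, hx, rfl⟩, _, ⟨y, hy, rfl⟩, rfl⟩
    refine lt_of_lt_of_le ?_ (H x y)
    have h1 : (ENNReal.ofReal t * a) ^ p < f x ^ p := ENNReal.rpow_lt_rpow hx hp
    have h2 : (ENNReal.ofReal t * b) ^ q < g y ^ q := ENNReal.rpow_lt_rpow hy hq
    have h3 : ENNReal.ofReal t * (a ^ p * b ^ q) =
        (ENNReal.ofReal t * a) ^ p * (ENNReal.ofReal t * b) ^ q := by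
      rw [ENNReal.mul_rpow_of_nonneg _ _ hp.le, ENNReal.mul_rpow_of_nonneg _ _ hq.le]
      have : ENNReal.ofReal t = ENNReal.ofReal t ^ p * ENNReal.ofReal t ^ q := by
        rw [← ENNReal.rpow_add_of_nonneg _ _ hp.le hq.le, hpq, ENNReal.rpow_one]
      conv_lhs => rw [this]
      ring
    rw [h3]
    exact ENNReal.mul_lt_mul h1 h2
  calc (∫⁻ x, f x) ^ p * (∫⁻ x, g x) ^ q = (a ^ p * b ^ q) * (I ^ p * J ^ q) := by
        rw [hfI, hgJ, ENNReal.mul_rpow_of_nonneg _ _ hp.le, ENNReal.mul_rpow_of_nonneg _ _ hq.le]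
        ring
    _ ≤ (a ^ p * b ^ q) * (ENNReal.ofReal p * I + ENNReal.ofReal q * J) := by
        gcongr
        exact ennreal_rpow_mul_rpow_le_add hp hq hpq I J
    _ ≤ (a ^ p * b ^ q) *
        ∫⁻ t in Ioo (0 : ℝ) 1, volume {x | ENNReal.ofReal t * (a ^ p * b ^ q) < h x} := by
        gcongr
        rw [hI, hJ, ← lintegral_const_mul' _ _ ENNReal.ofReal_ne_top,
          ← lintegral_const_mul' _ _ ENNReal.ofReal_ne_top]
        exact (le_lintegral_add _ _).trans (setLIntegral_mono' measurableSet_Ioo hmain)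
    _ = ∫⁻ x, min (h x) (a ^ p * b ^ q) :=
        (lintegral_min_eq_mul_lintegral_measure_lt hh.aemeasurable hc0 hct).symm
    _ ≤ ∫⁻ x, h x := lintegral_mono fun x => min_le_left _ _

theorem tendsto_lintegral_min_natCast {f : ℝ → ℝ≥0∞} (hf : Measurable f) :
    Tendsto (fun N : ℕ => ∫⁻ x, min (f x) N) atTop (𝓝 (∫⁻ x, f x)) := by
  refine lintegral_tendsto_of_tendsto_of_monotone (fun N => (hf.min measurable_const).aemeasurable)
    (Eventually.of_forall fun x m n hmn => min_le_min le_rfl (by exact_mod_cast hmn))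
    (Eventually.of_forall fun x => ?_)
  simpa using (tendsto_const_nhds (x := f x)).min ENNReal.tendsto_nat_nhds_top

/-- The Prékopa–Leindler inequality on the line. -/
theorem prekopaLeindler_real {f g h : ℝ → ℝ≥0∞} (hf : Measurable f)
    (hg : Measurable g) (hh : Measurable h) {p q : ℝ} (hp : 0 < p) (hq : 0 < q) (hpq : p + q = 1)
    (H : ∀ x y, f x ^ p * g y ^ q ≤ h (p * x + q * y)) :
    (∫⁻ x, f x) ^ p * (∫⁻ x, g x) ^ q ≤ ∫⁻ x, h x := by
  rcases eq_or_ne (∫⁻ x, f x) 0 with hF | hF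
  · simp [hF, hp]
  rcases eq_or_ne (∫⁻ x, g x) 0 with hG | hG
  · simp [hG, hq]
  have hne : ∀ {f : ℝ → ℝ≥0∞}, ∫⁻ x, f x ≠ 0 → ⨆ x, f x ≠ 0 := by
    intro f hF h0
    refine hF ?_
    rw [show f = 0 from funext fun x => by simpa using (le_iSup f x).trans_eq h0]
    simp
  have hlim : Tendsto (fun N : ℕ => (∫⁻ x, min (f x) N) ^ p * (∫⁻ x, min (g x) N) ^ q) atTop
      (𝓝 ((∫⁻ x, f x) ^ p * (∫⁻ x, g x) ^ q)) := by
    refine ENNReal.Tendsto.mul ((tendsto_lintegral_min_natCast hf).ennrpow_const p) (Or.inl ?_)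
      ((tendsto_lintegral_min_natCast hg).ennrpow_const q) (Or.inl ?_)
    · simp [hF, hp, hp.le]
    · simp [hG, hq, hq.le]
  have hF' := (tendsto_lintegral_min_natCast hf).eventually_ne hF
  have hG' := (tendsto_lintegral_min_natCast hg).eventually_ne hG
  refine le_of_tendsto hlim ?_
  filter_upwards [hF', hG'] with N h1 h2
  have hbd : ∀ f : ℝ → ℝ≥0∞, ⨆ x, min (f x) (N : ℝ≥0∞) ≠ ∞ := fun f =>
    ((iSup_le fun x => min_le_right _ _).trans_lt (ENNReal.natCast_lt_top N)).ne
  refine prekopaLeindler_real_of_iSup_ne_top (hf.min measurable_const) (hg.min measurable_const) hh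
    hp hq hpq (fun x y => le_trans ?_ (H x y)) (hne h1) (hbd f) (hne h2) (hbd g)
  gcongr <;> exact min_le_left _ _

/-! ### Log-concave functions and their marginals -/

/-- Log-concavity of a function with values in `[0, ∞]` on a real vector space. -/
def LogConcave {V : Type*} [AddCommGroup V] [Module ℝ V] (F : V → ℝ≥0∞) : Prop :=
  ∀ x y : V, ∀ p q : ℝ, 0 < p → 0 < q → p + q = 1 → F x ^ p * F y ^ q ≤ F (p • x + q • y)

section

variable {V W : Type*} [AddCommGroup V] [Module ℝ V] [AddCommGroup W] [Module ℝ W]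

theorem LogConcave.convex_le {F : V → ℝ≥0∞} (hF : LogConcave F) (t : ℝ≥0∞) :
    Convex ℝ {x | t ≤ F x} := by
  refine convex_iff_forall_pos.2 fun x hx y hy p q hp hq hpq => ?_
  calc t = t ^ p * t ^ q := by
        rw [← ENNReal.rpow_add_of_nonneg _ _ hp.le hq.le, hpq, ENNReal.rpow_one]
    _ ≤ F x ^ p * F y ^ q := by
        gcongr
        · exact hx
        · exact hy
    _ ≤ F (p • x + q • y) := hF x y p q hp hq hpq

theorem LogConcave.comp_linearMap {F : W → ℝ≥0∞} (hF : LogConcave F) (L : V →ₗ[ℝ] W) :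
    LogConcave fun x => F (L x) := by
  intro x y p q hp hq hpq
  simpa using hF (L x) (L y) p q hp hq hpq

theorem LogConcave.indicator {F : V → ℝ≥0∞} (hF : LogConcave F) {s : Set V} (hs : Convex ℝ s) :
    LogConcave (s.indicator F) := by
  intro x y p q hp hq hpq
  by_cases hx : x ∈ s
  · by_cases hy : y ∈ s
    · rw [indicator_of_mem hx, indicator_of_mem hy,
        indicator_of_mem (hs hx hy hp.le hq.le hpq)]
      exact hF x y p q hp hq hpq
    · simp [hy, hq]
  · simp [hx, hp]

theorem logConcave_one : LogConcave (fun _ : V => (1 : ℝ≥0∞)) := by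
  intro x y p q hp hq hpq
  simp

end

theorem LogConcave.aemeasurable {V : Type*} [NormedAddCommGroup V] [NormedSpace ℝ V]
    [FiniteDimensional ℝ V] [MeasurableSpace V] [BorelSpace V] (μ : Measure V)
    [μ.IsAddHaarMeasure] {F : V → ℝ≥0∞} (hF : LogConcave F) : AEMeasurable F μ := by
  have h : NullMeasurable F μ :=
    measurable_of_Ici (δ := NullMeasurableSpace V μ) fun t => (hF.convex_le t).nullMeasurableSet μ
  exact h.aemeasurable

theorem LogConcave.measurable {F : ℝ → ℝ≥0∞} (hF : LogConcave F) : Measurable F :=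
  measurable_of_Ici fun t => (hF.convex_le t).ordConnected.measurableSet

/-- A one-dimensional marginal of a log-concave function is log-concave. -/
theorem LogConcave.lintegral_real {V : Type*} [AddCommGroup V] [Module ℝ V]
    {F : V × ℝ → ℝ≥0∞} (hF : LogConcave F) : LogConcave fun v => ∫⁻ t, F (v, t) := by
  have hm : ∀ v, Measurable fun t => F (v, t) := by
    intro v
    refine LogConcave.measurable fun x y p q hp hq hpq => ?_
    have := hF (v, x) (v, y) p q hp hq hpq
    rwa [Prod.smul_mk, Prod.smul_mk, Prod.mk_add_mk, ← add_smul, hpq, one_smul] at this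
  intro v w p q hp hq hpq
  exact prekopaLeindler_real (hm v) (hm w) (hm _) hp hq hpq fun x y =>
    hF (v, x) (w, y) p q hp hq hpq

/-- Marginals of log-concave functions are log-concave, by integrating out one coordinate at a
time. -/
theorem LogConcave.lintegral_pi : ∀ (n : ℕ) {V : Type} [NormedAddCommGroup V] [NormedSpace ℝ V]
    {F : V × (Fin n → ℝ) → ℝ≥0∞}, LogConcave F → LogConcave fun v => ∫⁻ x, F (v, x)
  | 0, V, _, _, F, hF => by
    intro v w p q hp hq hpq
    have hint : ∀ v, ∫⁻ x, F (v, x) = F (v, 0) := by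
      intro v
      rw [lintegral_unique, show volume (univ : Set (Fin 0 → ℝ)) = 1 by simp [volume_pi], mul_one]
      exact congrArg (fun z => F (v, z)) (Subsingleton.elim _ _)
    simp only [hint]
    simpa using hF (v, 0) (w, 0) p q hp hq hpq
  | n + 1, V, _, _, F, hF => by
    -- The coordinate `t` joins the parameters while the other `n` coordinates are integrated out.
    let G : (V × ℝ) × (Fin n → ℝ) → ℝ≥0∞ := fun z => F (z.1.1, Fin.cons z.1.2 z.2)
    have hcons : ∀ (p q s t : ℝ) (x y : Fin n → ℝ),
        (Fin.cons (p * s + q * t) (p • x + q • y) : Fin (n + 1) → ℝ) =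
          p • (Fin.cons s x : Fin (n + 1) → ℝ) + q • (Fin.cons t y : Fin (n + 1) → ℝ) := by
      intro p q s t x y
      ext i
      refine Fin.cases ?_ (fun j => ?_) i <;> simp
    have hG : LogConcave G := by
      rintro ⟨⟨v, s⟩, x⟩ ⟨⟨w, t⟩, y⟩ p q hp hq hpq
      have := hF (v, Fin.cons s x) (w, Fin.cons t y) p q hp hq hpq
      simpa [G, hcons] using this
    have hmarg := (LogConcave.lintegral_pi n hG).lintegral_real
    have heq : ∀ v, ∫⁻ x, F (v, x) = ∫⁻ t : ℝ, ∫⁻ x : Fin n → ℝ, G ((v, t), x) := by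
      intro v
      have hslice : LogConcave fun z : ℝ × (Fin n → ℝ) => G ((v, z.1), z.2) := by
        rintro ⟨s, x⟩ ⟨t, y⟩ p q hp hq hpq
        have := hG ((v, s), x) ((v, t), y) p q hp hq hpq
        simpa [← add_smul, hpq] using this
      have hmp := (volume_preserving_piFinSuccAbove (fun _ : Fin (n + 1) => ℝ) 0).symm
      rw [← hmp.lintegral_comp_emb (MeasurableEquiv.measurableEmbedding _)]
      rw [← lintegral_prod (fun z : ℝ × (Fin n → ℝ) => G ((v, z.1), z.2))
        (hslice.aemeasurable ((volume : Measure ℝ).prod (volume : Measure (Fin n → ℝ))))]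
      refine lintegral_congr fun z => ?_
      simp [G, MeasurableEquiv.piFinSuccAbove]
      rfl
    simpa only [heq] using hmarg

theorem LogConcave.lintegral_euclidean {n : ℕ} {V : Type} [NormedAddCommGroup V] [NormedSpace ℝ V]
    {F : V × E n → ℝ≥0∞} (hF : LogConcave F) : LogConcave fun v => ∫⁻ x, F (v, x) := by
  let L : V × (Fin n → ℝ) →ₗ[ℝ] V × E n :=
    LinearMap.prodMap LinearMap.id (WithLp.linearEquiv 2 ℝ (Fin n → ℝ)).symm.toLinearMap
  have h := LogConcave.lintegral_pi n (hF.comp_linearMap L)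
  have heq : ∀ v, ∫⁻ x : E n, F (v, x) = ∫⁻ x : Fin n → ℝ, F (L (v, x)) := fun v =>
    ((PiLp.volume_preserving_toLp (Fin n)).lintegral_comp_emb
      (MeasurableEquiv.toLp 2 (Fin n → ℝ)).measurableEmbedding (fun x => F (v, x))).symm
  simpa only [heq] using h

theorem measurableSet_upperHalfSpace {n : ℕ} (θ : E n) (a : ℝ) :
    MeasurableSet (upperHalfSpace θ a) :=
  (isClosed_le (f := fun _ : E n => a) (g := fun x : E n => inner ℝ x θ) continuous_const
    (by fun_prop)).measurableSet

/-- The integral of a log-concave function over the half-spaces `{c ≤ ⟨x, θ⟩}` is log-concave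
in `c`. -/
theorem LogConcave.lintegral_upperHalfSpace {n : ℕ} {F : E n → ℝ≥0∞} (hF : LogConcave F)
    (θ : E n) : LogConcave fun c : ℝ => ∫⁻ x in upperHalfSpace θ c, F x := by
  have hs : Convex ℝ {z : ℝ × E n | z.1 ≤ inner ℝ z.2 θ} := by
    refine convex_iff_forall_pos.2 fun x hx y hy p q hp hq hpq => ?_
    simp only [mem_ofPred_eq, Prod.fst_add, Prod.snd_add, Prod.smul_fst, Prod.smul_snd,
      inner_add_left, real_inner_smul_left, smul_eq_mul] at hx hy ⊢
    nlinarith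
  have := ((hF.comp_linearMap (LinearMap.snd ℝ ℝ (E n))).indicator hs).lintegral_euclidean
  convert! this using 1
  ext c
  rw [← lintegral_indicator (measurableSet_upperHalfSpace θ c)]
  rfl

/-- The volume of the intersection of a convex set with the slabs `{c ≤ ⟨x, θ⟩ ≤ c + w}` is
log-concave in `c`. -/
theorem logConcave_volume_slab {n : ℕ} {C : Set (E n)} (hC : Convex ℝ C) (hCm : MeasurableSet C)
    (θ : E n) (w : ℝ) :
    LogConcave fun c : ℝ => volume (C ∩ {x | c ≤ inner ℝ x θ ∧ inner ℝ x θ ≤ c + w}) := by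
  have hs : Convex ℝ {z : ℝ × E n | z.2 ∈ C ∧ z.1 ≤ inner ℝ z.2 θ ∧ inner ℝ z.2 θ ≤ z.1 + w} := by
    refine convex_iff_forall_pos.2 fun x hx y hy p q hp hq hpq => ?_
    refine ⟨hC hx.1 hy.1 hp.le hq.le hpq, ?_⟩
    obtain ⟨-, hx1, hx2⟩ := hx
    obtain ⟨-, hy1, hy2⟩ := hy
    obtain rfl : q = 1 - p := by linarith
    simp only [Prod.fst_add, Prod.snd_add, Prod.smul_fst, Prod.smul_snd,
      inner_add_left, real_inner_smul_left, smul_eq_mul]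
    constructor <;> nlinarith
  have := ((logConcave_one (V := ℝ × E n)).indicator hs).lintegral_euclidean
  convert! this using 1
  ext c
  rw [← lintegral_indicator_one]
  · rfl
  · refine hCm.inter (IsClosed.measurableSet ?_)
    exact (isClosed_le (f := fun _ : E n => c) (g := fun x : E n => inner ℝ x θ) (by fun_prop)
      (by fun_prop)).inter (isClosed_le (f := fun x : E n => inner ℝ x θ)
        (g := fun _ : E n => c + w) (by fun_prop) (by fun_prop))

/-! ### Half-spaces and symmetry -/

theorem lintegral_comp_neg {n : ℕ} (g : E n → ℝ≥0∞) : ∫⁻ x, g (-x) = ∫⁻ x, g x :=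
  (Measure.measurePreserving_neg (volume : Measure (E n))).lintegral_comp_emb
    (MeasurableEquiv.neg (E n)).measurableEmbedding g

theorem volume_preimage_neg {n : ℕ} (A : Set (E n)) :
    volume ((fun x => -x) ⁻¹' A) = volume A :=
  (Measure.measurePreserving_neg (volume : Measure (E n))).measure_preimage_emb
    (MeasurableEquiv.neg (E n)).measurableEmbedding A

/-- A half-space containing the origin carries at least half of the integral of an even
function. -/
theorem lintegral_le_two_mul_lintegral_upperHalfSpace {n : ℕ} {F : E n → ℝ≥0∞}
    (hF : ∀ x, F (-x) = F x) (θ : E n) {c : ℝ} (hc : c ≤ 0) :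
    ∫⁻ x, F x ≤ 2 * ∫⁻ x in upperHalfSpace θ c, F x := by
  have hU := measurableSet_upperHalfSpace θ c
  have hcover : upperHalfSpace θ c ∪ (fun x => -x) ⁻¹' upperHalfSpace θ c = univ := by
    refine eq_univ_of_forall fun x => ?_
    rcases le_total 0 (inner ℝ x θ) with h | h
    · exact Or.inl (hc.trans h)
    · exact Or.inr (by simp only [mem_preimage, upperHalfSpace, mem_ofPred_eq, inner_neg_left]
                       linarith)
  have hneg : ∫⁻ x in (fun x => -x) ⁻¹' upperHalfSpace θ c, F x
      = ∫⁻ x in upperHalfSpace θ c, F x := by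
    rw [← lintegral_indicator (hU.preimage measurable_neg), ← lintegral_indicator hU,
      ← lintegral_comp_neg ((upperHalfSpace θ c).indicator F)]
    refine lintegral_congr fun x => ?_
    by_cases h : -x ∈ upperHalfSpace θ c
    · rw [indicator_of_mem (by exact h), indicator_of_mem h, hF]
    · rw [indicator_of_notMem (by exact h), indicator_of_notMem h]
  calc ∫⁻ x, F x = ∫⁻ x in upperHalfSpace θ c ∪ (fun x => -x) ⁻¹' upperHalfSpace θ c, F x := by
        rw [hcover, Measure.restrict_univ]
    _ ≤ _ := lintegral_union_le _ _ _
    _ = 2 * ∫⁻ x in upperHalfSpace θ c, F x := by rw [hneg, two_mul]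

theorem volume_hyperplane {n : ℕ} {θ : E n} (hθ : θ ≠ 0) (c : ℝ) :
    volume {x : E n | inner ℝ x θ = c} = 0 := by
  let A : AffineSubspace ℝ (E n) :=
    (AffineSubspace.mk' c ⊥).comap ((innerSL ℝ θ).toLinearMap.toAffineMap)
  have hA : {x : E n | inner ℝ x θ = c} = A := by
    ext x
    simp [A, AffineSubspace.mem_mk', sub_eq_zero, real_inner_comm]
  rw [hA]
  refine Measure.addHaar_affineSubspace _ _ fun htop => ?_
  have h : ∀ x : E n, inner ℝ x θ = c := fun x => by
    have : x ∈ (A : Set (E n)) := by rw [htop]; trivial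
    rwa [← hA] at this
  have h0 := h 0
  have h1 := h θ
  rw [inner_zero_left] at h0
  rw [← h0] at h1
  exact hθ (inner_self_eq_zero.1 h1)

/-! ### Tilting a half-space -/

/-- For a symmetric convex set, moving a slab towards the origin increases the volume that it
cuts off. -/
theorem volume_slab_le {n : ℕ} {C : Set (E n)} (hC : Convex ℝ C) (hCm : MeasurableSet C)
    (hsymm : ∀ x ∈ C, -x ∈ C) (θ : E n) {c w : ℝ} (hc : 0 < c) (hw : 0 ≤ w) :
    volume (C ∩ {x | c ≤ inner ℝ x θ ∧ inner ℝ x θ ≤ c + w}) ≤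
      volume (C ∩ {x | c - w ≤ inner ℝ x θ ∧ inner ℝ x θ ≤ c - w + w}) := by
  rcases hw.eq_or_lt with rfl | hw
  · simp
  set Φ : ℝ → ℝ≥0∞ :=
    fun c => volume (C ∩ {x | c ≤ inner ℝ x θ ∧ inner ℝ x θ ≤ c + w}) with hΦ
  have hLC : LogConcave Φ := logConcave_volume_slab hC hCm θ w
  have hrefl : Φ (-c - w) = Φ c := by
    rw [hΦ]
    simp only
    rw [← volume_preimage_neg]
    congr 1
    ext x
    simp only [mem_preimage, mem_inter_iff, mem_ofPred_eq, inner_neg_left]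
    constructor
    · rintro ⟨h1, h2, h3⟩
      exact ⟨by simpa using hsymm _ h1, by linarith, by linarith⟩
    · rintro ⟨h1, h2, h3⟩
      exact ⟨hsymm _ h1, by linarith, by linarith⟩
  -- `c - w` lies between `c` and `-c - w`, the position of the reflected slab.
  have h := hLC c (-c - w) (2 * c / (2 * c + w)) (w / (2 * c + w)) (by positivity) (by positivity)
    (by field_simp)
  rw [hrefl, ← ENNReal.rpow_add_of_nonneg _ _ (by positivity) (by positivity),
    show 2 * c / (2 * c + w) + w / (2 * c + w) = 1 by field_simp, ENNReal.rpow_one,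
    show (2 * c / (2 * c + w)) • c + (w / (2 * c + w)) • (-c - w) = c - w by
      simp only [smul_eq_mul]; field_simp; ring] at h
  exact h

theorem two_mul_volume_inter_upperHalfSpace_le {n : ℕ} {C : Set (E n)} (hC : Convex ℝ C)
    (hCm : MeasurableSet C) (hsymm : ∀ x ∈ C, -x ∈ C) {θ : E n} (hθ : θ ≠ 0) {c : ℝ} (hc : 0 < c)
    (w : ℝ) :
    2 * volume (C ∩ upperHalfSpace θ c) ≤
      volume (C ∩ upperHalfSpace θ (c - w)) + volume (C ∩ upperHalfSpace θ (c + w)) := by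
  wlog hw : 0 ≤ w generalizing w
  · have := this (-w) (by linarith)
    rwa [sub_neg_eq_add, ← sub_eq_add_neg, add_comm (volume _)] at this
  set S := C ∩ {x | c ≤ inner ℝ x θ ∧ inner ℝ x θ ≤ c + w} with hS
  set T := C ∩ {x | c - w ≤ inner ℝ x θ ∧ inner ℝ x θ ≤ c - w + w} with hT
  have hST : volume S ≤ volume T := volume_slab_le hC hCm hsymm θ hc hw
  have h1 : volume (C ∩ upperHalfSpace θ c) ≤
      volume S + volume (C ∩ upperHalfSpace θ (c + w)) := by
    refine (measure_mono ?_).trans (measure_union_le _ _)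
    rintro x ⟨hx, hxc⟩
    rcases le_total (inner ℝ x θ) (c + w) with h | h
    · exact Or.inl ⟨hx, hxc, h⟩
    · exact Or.inr ⟨hx, h⟩
  have h2 : volume T + volume (C ∩ upperHalfSpace θ c) ≤
      volume (C ∩ upperHalfSpace θ (c - w)) := by
    rw [← measure_union₀ ((hCm.inter (measurableSet_upperHalfSpace θ c)).nullMeasurableSet)]
    · refine measure_mono (union_subset ?_ ?_)
      · rintro x ⟨hx, h, -⟩
        exact ⟨hx, h⟩
      · rintro x ⟨hx, h⟩
        exact ⟨hx, (sub_le_self c hw).trans h⟩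
    · refine measure_mono_null ?_ (volume_hyperplane hθ c)
      rintro x ⟨⟨-, -, h⟩, -, h'⟩
      simp only [upperHalfSpace, mem_ofPred_eq] at h' ⊢
      linarith
  calc 2 * volume (C ∩ upperHalfSpace θ c)
      ≤ (volume S + volume (C ∩ upperHalfSpace θ (c + w))) +
          volume (C ∩ upperHalfSpace θ c) := by rw [two_mul]; gcongr
    _ ≤ (volume T + volume (C ∩ upperHalfSpace θ (c + w))) +
          volume (C ∩ upperHalfSpace θ c) := by gcongr
    _ = (volume T + volume (C ∩ upperHalfSpace θ c)) +
          volume (C ∩ upperHalfSpace θ (c + w)) := by ring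
    _ ≤ _ := by gcongr

/-- Let `K ⊆ ℝⁿ × ℝˢ` be invariant under both coordinate reflections, with convex horizontal
slices. Among the half-spaces `{c ≤ ⟨x, θ⟩ + ⟨y, η⟩}`, the one with `η = 0` cuts off the least
volume: the slices over `y` and `-y` are compared as pairs. -/
theorem volume_inter_upperHalfSpace_le_tilt {n s : ℕ} {K : Set (E n × E s)} (hK : MeasurableSet K)
    (hconv : ∀ y, Convex ℝ {x | (x, y) ∈ K}) (h1 : ∀ x y, (x, y) ∈ K → (-x, y) ∈ K)
    (h2 : ∀ x y, (x, y) ∈ K → (x, -y) ∈ K) {θ : E n} (hθ : θ ≠ 0) (η : E s) {c : ℝ}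
    (hc : 0 < c) :
    volume (K ∩ {z | c ≤ inner ℝ z.1 θ}) ≤
      volume (K ∩ {z | c ≤ inner ℝ z.1 θ + inner ℝ z.2 η}) := by
  set A := K ∩ {z | c ≤ inner ℝ z.1 θ + inner ℝ z.2 η} with hA
  set A' := K ∩ {z : E n × E s | c ≤ inner ℝ z.1 θ} with hA'
  have hmA : MeasurableSet A := hK.inter (isClosed_le (f := fun _ : E n × E s => c)
    (g := fun z : E n × E s => inner ℝ z.1 θ + inner ℝ z.2 η) (by fun_prop)
    (by fun_prop)).measurableSet
  have hmA' : MeasurableSet A' := hK.inter (isClosed_le (f := fun _ : E n × E s => c)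
    (g := fun z : E n × E s => inner ℝ z.1 θ) (by fun_prop) (by fun_prop)).measurableSet
  set v : E s → ℝ≥0∞ := fun y => volume {x | (x, y) ∈ A} with hv
  have hvm : Measurable v := measurable_measure_prodMk_right hmA
  have hvA : volume A = ∫⁻ y, v y := Measure.prod_apply_symm hmA
  have hslice : ∀ y, 2 * volume {x | (x, y) ∈ A'} ≤ v y + v (-y) := by
    intro y
    have key := two_mul_volume_inter_upperHalfSpace_le (hconv y)
      (hK.preimage measurable_prodMk_right) (fun x hx => h1 x y hx) hθ hc (inner ℝ y η)
    have e1 : {x | (x, y) ∈ A} = {x | (x, y) ∈ K} ∩ upperHalfSpace θ (c - inner ℝ y η) := by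
      ext x
      simp [hA, upperHalfSpace]
    have e2 : {x | (x, -y) ∈ A} = {x | (x, y) ∈ K} ∩ upperHalfSpace θ (c + inner ℝ y η) := by
      ext x
      simp only [hA, upperHalfSpace, mem_inter_iff, mem_ofPred_eq, inner_neg_left]
      have : (x, -y) ∈ K ↔ (x, y) ∈ K := ⟨fun h => by simpa using h2 _ _ h, h2 x y⟩
      rw [this]
      refine and_congr_right fun _ => ⟨fun h => by linarith, fun h => by linarith⟩
    have e3 : {x | (x, y) ∈ A'} = {x | (x, y) ∈ K} ∩ upperHalfSpace θ c := by
      ext x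
      simp [hA', upperHalfSpace]
    simpa only [hv, e1, e2, e3] using key
  have h22 : 2 * volume A' ≤ 2 * volume A := by
    calc 2 * volume A' = ∫⁻ y, 2 * volume {x | (x, y) ∈ A'} := by
          rw [lintegral_const_mul' _ _ (by simp)]
          congr 1
          exact Measure.prod_apply_symm hmA'
      _ ≤ ∫⁻ y, (v y + v (-y)) := lintegral_mono hslice
      _ = 2 * volume A := by
          rw [lintegral_add_left hvm, lintegral_comp_neg, hvA, two_mul]
  exact (ENNReal.mul_le_mul_iff_right (by simp) (by simp)).1 h22

/-! ### Volumes of Euclidean balls -/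

theorem mul_Gamma_sq_le {y : ℝ} (hy : 1 / 2 < y) :
    (y - 1 / 2) * Real.Gamma y ^ 2 ≤ Real.Gamma (y + 1 / 2) ^ 2 := by
  have h0 : 0 < y - 1 / 2 := by linarith
  have hG : Real.Gamma (y + 1 / 2) = (y - 1 / 2) * Real.Gamma (y - 1 / 2) := by
    rw [← Real.Gamma_add_one h0.ne']
    congr 1
    ring
  have hlc := Real.Gamma_mul_add_mul_le_rpow_Gamma_mul_rpow_Gamma h0
    (show 0 < y + 1 / 2 by linarith) (show (0 : ℝ) < 1 / 2 by norm_num)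
    (show (0 : ℝ) < 1 / 2 by norm_num) (by norm_num)
  rw [show (1 / 2 : ℝ) * (y - 1 / 2) + 1 / 2 * (y + 1 / 2) = y by ring,
    ← Real.mul_rpow (Real.Gamma_pos_of_pos h0).le (Real.Gamma_pos_of_pos (by linarith)).le,
    ← Real.sqrt_eq_rpow] at hlc
  have hpos : 0 ≤ Real.Gamma (y - 1 / 2) * Real.Gamma (y + 1 / 2) :=
    mul_nonneg (Real.Gamma_pos_of_pos h0).le (Real.Gamma_pos_of_pos (by linarith)).le
  have hsq : Real.Gamma y ^ 2 ≤ Real.Gamma (y - 1 / 2) * Real.Gamma (y + 1 / 2) := by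
    rw [← Real.sq_sqrt hpos]
    exact pow_le_pow_left₀ (Real.Gamma_pos_of_pos (by linarith)).le hlc 2
  calc (y - 1 / 2) * Real.Gamma y ^ 2
      ≤ (y - 1 / 2) * (Real.Gamma (y - 1 / 2) * Real.Gamma (y + 1 / 2)) := by gcongr
    _ = Real.Gamma (y + 1 / 2) ^ 2 := by rw [← mul_assoc, ← hG, sq]

theorem volume_closedBall_one {m : ℕ} (hm : 0 < m) :
    volume (Metric.closedBall (0 : E m) 1) =
      ENNReal.ofReal (√Real.pi ^ m / Real.Gamma (m / 2 + 1)) := by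
  have : Nonempty (Fin m) := ⟨⟨0, hm⟩⟩
  rw [EuclideanSpace.volume_closedBall]
  simp

/-- Consecutive unit-ball volumes satisfy `m κ_{m+1}² ≤ 2π κ_m²`, by log-convexity of `Γ`. -/
theorem mul_volume_closedBall_succ_sq_le {m : ℕ} (hm : 0 < m) :
    (m : ℝ≥0∞) * volume (Metric.closedBall (0 : E (m + 1)) 1) ^ 2 ≤
      ENNReal.ofReal (2 * Real.pi) * volume (Metric.closedBall (0 : E m) 1) ^ 2 := by
  rw [volume_closedBall_one hm, volume_closedBall_one (Nat.succ_pos m),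
    ← ENNReal.ofReal_pow (by positivity), ← ENNReal.ofReal_pow (by positivity),
    ← ENNReal.ofReal_natCast, ← ENNReal.ofReal_mul (by positivity),
    ← ENNReal.ofReal_mul (by positivity)]
  refine ENNReal.ofReal_le_ofReal ?_
  have h := mul_Gamma_sq_le (y := m / 2 + 1) (by have := m.cast_nonneg (α := ℝ); linarith)
  have hG1 : 0 < Real.Gamma (m / 2 + 1) := Real.Gamma_pos_of_pos (by positivity)
  have hG2 : 0 < Real.Gamma (m / 2 + 1 + 1 / 2) := Real.Gamma_pos_of_pos (by positivity)
  rw [show ((m + 1 : ℕ) : ℝ) / 2 + 1 = m / 2 + 1 + 1 / 2 by push_cast; ring]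
  rw [div_pow, div_pow, ← mul_div_assoc, ← mul_div_assoc, div_le_div_iff₀ (by positivity)
    (by positivity), show (√Real.pi ^ m.succ) ^ 2 = (√Real.pi ^ m) ^ 2 * Real.pi by
      rw [Nat.succ_eq_add_one, pow_succ (√Real.pi) m, mul_pow, Real.sq_sqrt Real.pi_pos.le]]
  have hsqrt : 0 ≤ (√Real.pi ^ m) ^ 2 * Real.pi := by positivity
  nlinarith [mul_le_mul_of_nonneg_left h hsqrt,
    mul_nonneg hsqrt (sq_nonneg (Real.Gamma (m / 2 + 1)))]

theorem pow_mul_volume_closedBall_sq_le {s : ℕ} (hs : 0 < s) (n : ℕ) :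
    (s : ℝ≥0∞) ^ n * volume (Metric.closedBall (0 : E (n + s)) 1) ^ 2 ≤
      ENNReal.ofReal (2 * Real.pi) ^ n * volume (Metric.closedBall (0 : E s) 1) ^ 2 := by
  induction n with
  | zero =>
    rw [Nat.zero_add]
    simp
  | succ n ih =>
    have h := mul_volume_closedBall_succ_sq_le (m := n + s) (by omega)
    rw [show n + 1 + s = n + s + 1 by omega]
    calc (s : ℝ≥0∞) ^ (n + 1) * volume (Metric.closedBall (0 : E (n + s + 1)) 1) ^ 2
        ≤ (s : ℝ≥0∞) ^ n * (((n + s : ℕ) : ℝ≥0∞) *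
            volume (Metric.closedBall (0 : E (n + s + 1)) 1) ^ 2) := by
          rw [pow_succ, mul_assoc]
          gcongr
          omega
      _ ≤ (s : ℝ≥0∞) ^ n * (ENNReal.ofReal (2 * Real.pi) *
            volume (Metric.closedBall (0 : E (n + s)) 1) ^ 2) := by gcongr
      _ = ENNReal.ofReal (2 * Real.pi) * ((s : ℝ≥0∞) ^ n *
            volume (Metric.closedBall (0 : E (n + s)) 1) ^ 2) := by ring
      _ ≤ ENNReal.ofReal (2 * Real.pi) * (ENNReal.ofReal (2 * Real.pi) ^ n *
            volume (Metric.closedBall (0 : E s) 1) ^ 2) := by gcongr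
      _ = _ := by ring

theorem volume_closedBall_eq {s : ℕ} {r : ℝ} (hr : 0 ≤ r) :
    volume (Metric.closedBall (0 : E s) r) =
      ENNReal.ofReal r ^ s * volume (Metric.closedBall (0 : E s) 1) := by
  rw [Measure.addHaar_closedBall' _ _ hr, finrank_euclideanSpace, Fintype.card_fin,
    ENNReal.ofReal_pow hr]

/-! ### Convex bodies in a product of Euclidean spaces -/

/-- `ℝⁿ × ℝˢ` is isometric to `ℝⁿ⁺ˢ`. The product type carries the maximum norm, hence the
isometry is expressed by the scalar product. -/
theorem exists_prodEquiv (n s : ℕ) : ∃ j : (E n × E s) ≃L[ℝ] E (n + s),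
    MeasurePreserving j ∧ ∀ z w, inner ℝ (j z) (j w) = inner ℝ z.1 w.1 + inner ℝ z.2 w.2 := by
  have hrank : Module.finrank ℝ (WithLp 2 (E n × E s)) = n + s := by
    rw [(WithLp.linearEquiv 2 ℝ (E n × E s)).finrank_eq]
    simp
  let ι : WithLp 2 (E n × E s) ≃ₗᵢ[ℝ] E (n + s) :=
    ((stdOrthonormalBasis ℝ _).reindex (finCongr hrank)).repr
  refine ⟨(WithLp.prodContinuousLinearEquiv 2 ℝ (E n) (E s)).symm.trans
    ι.toContinuousLinearEquiv, ?_, fun z w => ?_⟩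
  · exact ι.measurePreserving.comp (WithLp.volume_preserving_toLp (U := E n) (V := E s))
  · simp only [ContinuousLinearEquiv.trans_apply]
    exact (ι.inner_map_map _ _).trans (WithLp.prod_inner_apply _ _)

/-- The inclusion of the floating body in the Santaló region, for a convex body in `ℝⁿ × ℝˢ` in
place of `ℝⁿ⁺ˢ`. -/
theorem volume_mul_volume_polar_le_of_prod {n s : ℕ} {l d : ℝ}
    (hbody : ∀ K : Set (E (n + s)), IsConvexBody K → IsCentrallySymmetric K →
      bodyFloatingBody K l ⊆ bodySantaloRegion K d)
    {K : Set (E n × E s)} (hc : IsCompact K) (hconv : Convex ℝ K) (h0 : 0 ∈ interior K)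
    (hsymm : ∀ z ∈ K, -z ∈ K) (b : E n × E s)
    (hb : ∀ (θ : E n) (η : E s) (α : ℝ),
      volume (K ∩ {z | α ≤ inner ℝ z.1 θ + inner ℝ z.2 η}) = ENNReal.ofReal l * volume K →
        inner ℝ b.1 θ + inner ℝ b.2 η ≤ α) :
    volume K * volume {w : E n × E s |
        ∀ z ∈ K, inner ℝ w.1 (z.1 - b.1) + inner ℝ w.2 (z.2 - b.2) ≤ 1} ≤
      ENNReal.ofReal d * volume (Metric.closedBall (0 : E (n + s)) 1) ^ 2 := by
  obtain ⟨j, hj, hinner⟩ := exists_prodEquiv n s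
  have hvol : ∀ A : Set (E n × E s), volume (j '' A) = volume A := by
    intro A
    have hemb : MeasurableEmbedding j := j.toHomeomorph.measurableEmbedding
    rw [← hj.measure_preimage_emb hemb, preimage_image_eq _ j.injective]
  have hK : IsConvexBody (j '' K) := by
    refine ⟨hc.image j.continuous, hconv.linear_image j.toLinearMap, ?_⟩
    have : j '' interior K = interior (j '' K) := j.toHomeomorph.image_interior K
    rw [← this]
    exact ⟨0, h0, map_zero j⟩
  have hsymm' : IsCentrallySymmetric (j '' K) := by
    have : ∀ x, x ∈ j '' K → -x ∈ j '' K := by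
      rintro _ ⟨z, hz, rfl⟩
      exact ⟨-z, hsymm z hz, map_neg j z⟩
    exact fun x => ⟨this x, fun h => by simpa using this _ h⟩
  have hfl : j b ∈ bodyFloatingBody (j '' K) l := by
    intro θ _ a ha
    obtain ⟨w, rfl⟩ := j.surjective θ
    have : upperHalfSpace (j w) a ∩ j '' K =
        j '' (K ∩ {z | a ≤ inner ℝ z.1 w.1 + inner ℝ z.2 w.2}) := by
      ext x
      obtain ⟨z, rfl⟩ := j.surjective x
      simp only [upperHalfSpace, mem_inter_iff, mem_ofPred_eq, hinner, j.injective.mem_set_image]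
      exact and_comm
    rw [this, hvol, hvol] at ha
    simpa [lowerHalfSpace, hinner] using hb w.1 w.2 a ha
  obtain ⟨-, h⟩ := hbody _ hK hsymm' hfl
  refine le_trans ?_ h
  rw [hvol]
  gcongr
  have : (fun x => j b + x) '' (j '' {w : E n × E s |
        ∀ z ∈ K, inner ℝ w.1 (z.1 - b.1) + inner ℝ w.2 (z.2 - b.2) ≤ 1}) ⊆
      polarAt (j '' K) (j b) := by
    rintro _ ⟨_, ⟨w, hw, rfl⟩, rfl⟩
    refine ⟨j w, rfl, ?_⟩
    rintro _ ⟨z, hz, rfl⟩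
    rw [← map_sub, hinner]
    exact hw z hz
  refine le_trans (le_of_eq ?_) (measure_mono this)
  rw [image_add_left, measure_preimage_add, hvol]

/-! ### Exponentials and powers -/

theorem exp_neg_sub_two_mul_sq_le {x : ℝ} (hx : |x| ≤ 1 / 2) :
    Real.exp (-x - 2 * x ^ 2) ≤ 1 - x := by
  obtain ⟨h1, h2⟩ := abs_le.1 hx
  have hpos : 0 < 1 - x := by linarith
  have h3 : x / (1 - x) ≤ x + 2 * x ^ 2 := by
    rw [div_le_iff₀ hpos]
    nlinarith [mul_nonneg (sq_nonneg x) (show 0 ≤ 1 - 2 * x by linarith)]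
  have h4 : (1 - x)⁻¹ ≤ Real.exp (x / (1 - x)) := by
    refine le_trans (le_of_eq ?_) (Real.add_one_le_exp _)
    field_simp
    ring
  calc Real.exp (-x - 2 * x ^ 2) ≤ Real.exp (-(x / (1 - x))) := Real.exp_le_exp.2 (by linarith)
    _ = (Real.exp (x / (1 - x)))⁻¹ := Real.exp_neg _
    _ ≤ 1 - x := by
      rw [inv_le_comm₀ (Real.exp_pos _) hpos]
      exact h4

/-- A lower bound for `(1 - z / s) ^ s`, uniform over `|z| ≤ M`. -/
theorem exp_sub_le_one_sub_div_pow {s : ℕ} (hs : 0 < s) {M z : ℝ} (hz : |z| ≤ M)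
    (hM : 2 * M ≤ s) : Real.exp (-(2 * M ^ 2 / s)) * Real.exp (-z) ≤ (1 - z / s) ^ s := by
  have hs' : (0 : ℝ) < s := by exact_mod_cast hs
  have habs : |z / s| ≤ 1 / 2 := by
    rw [abs_div, abs_of_pos hs', div_le_iff₀ hs']
    linarith
  have hzM : z ^ 2 ≤ M ^ 2 := sq_le_sq' (abs_le.1 hz).1 (abs_le.1 hz).2
  calc Real.exp (-(2 * M ^ 2 / s)) * Real.exp (-z)
      ≤ Real.exp (s * (-(z / s) - 2 * (z / s) ^ 2)) := by
        rw [← Real.exp_add]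
        refine Real.exp_le_exp.2 ?_
        have : (s : ℝ) * (-(z / s) - 2 * (z / s) ^ 2) = -z - 2 * z ^ 2 / s := by
          field_simp
        rw [this]
        have : 2 * z ^ 2 / s ≤ 2 * M ^ 2 / s := by gcongr
        linarith
    _ = Real.exp (-(z / s) - 2 * (z / s) ^ 2) ^ s := Real.exp_nat_mul _ _
    _ ≤ (1 - z / s) ^ s :=
        pow_le_pow_left₀ (Real.exp_pos _).le (exp_neg_sub_two_mul_sq_le habs) s

/-! ### The convex body over a concave function -/

/-- The body of revolution `{(x, y) : x ∈ C, |y| ≤ 1 + ψ(x) / s}` in `ℝⁿ × ℝˢ`. Up to the volume of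
the unit ball of `ℝˢ`, its marginal on `ℝⁿ` is the function `(1 + ψ / s) ^ s` on `C`, which
approximates `exp ψ`. -/
def bodyOver {n : ℕ} (s : ℕ) (C : Set (E n)) (ψ : E n → ℝ) : Set (E n × E s) :=
  {z | z.1 ∈ C ∧ ‖z.2‖ ≤ 1 + ψ z.1 / s}

section

variable {n s : ℕ} {C : Set (E n)} {ψ : E n → ℝ}

theorem convex_bodyOver (hψ : ConcaveOn ℝ C ψ) : Convex ℝ (bodyOver s C ψ) := by
  refine convex_iff_forall_pos.2 fun z hz w hw p q hp hq hpq => ?_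
  refine ⟨hψ.1 hz.1 hw.1 hp.le hq.le hpq, ?_⟩
  have h1 : ‖p • z.2 + q • w.2‖ ≤ p * ‖z.2‖ + q * ‖w.2‖ := by
    refine (norm_add_le _ _).trans (le_of_eq ?_)
    rw [norm_smul, norm_smul, Real.norm_of_nonneg hp.le, Real.norm_of_nonneg hq.le]
  have h2 := hψ.2 hz.1 hw.1 hp.le hq.le hpq
  simp only [smul_eq_mul] at h2
  calc ‖p • z.2 + q • w.2‖ ≤ p * (1 + ψ z.1 / s) + q * (1 + ψ w.1 / s) := by
        refine h1.trans ?_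
        gcongr
        · exact hz.2
        · exact hw.2
    _ = 1 + (p * ψ z.1 + q * ψ w.1) / s := by linear_combination hpq
    _ ≤ 1 + ψ (p • z.1 + q • w.1) / s := by gcongr

theorem isBounded_bodyOver (hC : Bornology.IsBounded C) (hψ : ∀ x ∈ C, ψ x ≤ 0) :
    Bornology.IsBounded (bodyOver s C ψ) := by
  refine (hC.prod (Metric.isBounded_closedBall (x := (0 : E s)) (r := 1))).subset ?_
  rintro z ⟨h1, h2⟩
  refine ⟨h1, ?_⟩
  rw [mem_closedBall_zero_iff]
  have := div_nonpos_of_nonpos_of_nonneg (hψ _ h1) s.cast_nonneg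
  linarith

theorem zero_mem_interior_bodyOver (hC : 0 ∈ interior C) {N : ℝ} (hψ : ∀ x ∈ C, -N ≤ ψ x)
    (hN : N < s) (hs : 0 < s) : 0 ∈ interior (bodyOver s C ψ) := by
  have hs' : (0 : ℝ) < s := by exact_mod_cast hs
  have hr : 0 < 1 - N / s := by
    rw [sub_pos, div_lt_one hs']
    exact hN
  rw [mem_interior_iff_mem_nhds] at hC ⊢
  refine mem_of_superset (prod_mem_nhds hC (Metric.closedBall_mem_nhds (0 : E s) hr)) ?_
  rintro z ⟨h1, h2⟩
  refine ⟨h1, ?_⟩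
  rw [mem_closedBall_zero_iff] at h2
  have : -N / s ≤ ψ z.1 / s := by
    gcongr
    exact hψ _ h1
  rw [neg_div] at this
  linarith

/-- Fubini for convex sets, whose sections are null measurable. -/
theorem volume_eq_lintegral_section_of_convex {A : Set (E n × E s)} (hA : Convex ℝ A) :
    volume A = ∫⁻ x, volume {y | (x, y) ∈ A} := by
  have hAm : NullMeasurableSet A ((volume : Measure (E n)).prod (volume : Measure (E s))) :=
    hA.nullMeasurableSet _
  have hsec : ∀ x, Convex ℝ {y | (x, y) ∈ A} := by
    intro x y hy y' hy' p q hp hq hpq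
    have := hA hy hy' hp hq hpq
    rwa [Prod.smul_mk, Prod.smul_mk, Prod.mk_add_mk, ← add_smul, hpq, one_smul] at this
  rw [Measure.volume_eq_prod, ← lintegral_indicator_one₀ hAm, lintegral_prod]
  · refine lintegral_congr fun x => ?_
    rw [← lintegral_indicator_one₀ ((hsec x).nullMeasurableSet _)]
    rfl
  · exact (aemeasurable_indicator_const_iff 1).2 hAm

theorem volume_bodyOver (hψ : ConcaveOn ℝ C ψ) (hψs : ∀ x ∈ C, 0 ≤ 1 + ψ x / s) :
    volume (bodyOver s C ψ) =
      volume (Metric.closedBall (0 : E s) 1) * ∫⁻ x in C, ENNReal.ofReal ((1 + ψ x / s) ^ s) := by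
  rw [volume_eq_lintegral_section_of_convex (convex_bodyOver hψ),
    ← lintegral_const_mul' _ _ (isCompact_closedBall _ _).measure_lt_top.ne,
    ← lintegral_indicator₀ (hψ.1.nullMeasurableSet _)]
  refine lintegral_congr fun x => ?_
  by_cases hx : x ∈ C
  · rw [indicator_of_mem hx]
    have : {y : E s | (x, y) ∈ bodyOver s C ψ} = Metric.closedBall 0 (1 + ψ x / s) := by
      ext y
      simp [bodyOver, hx]
    rw [this, volume_closedBall_eq (hψs x hx), ENNReal.ofReal_pow (hψs x hx), mul_comm]
  · rw [indicator_of_notMem hx]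
    have : {y : E s | (x, y) ∈ bodyOver s C ψ} = ∅ := by
      ext y
      simp [bodyOver, hx]
    rw [this, measure_empty]

theorem volume_bodyOver_le (hψ : ConcaveOn ℝ C ψ) {N : ℝ} (hψN : ∀ x ∈ C, -N ≤ ψ x)
    (hs : 0 < s) (hN : N ≤ s) :
    volume (bodyOver s C ψ) ≤
      volume (Metric.closedBall (0 : E s) 1) * ∫⁻ x in C, ENNReal.ofReal (Real.exp (ψ x)) := by
  have hs' : (0 : ℝ) < s := by exact_mod_cast hs
  rw [volume_bodyOver hψ]
  · gcongr 1
    refine lintegral_mono_ae ((ae_restrict_iff'₀ (hψ.1.nullMeasurableSet _)).2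
      (Eventually.of_forall fun x hx => ?_))
    refine ENNReal.ofReal_le_ofReal ?_
    have := Real.one_sub_div_pow_le_exp_neg (n := s) (t := -ψ x) (by linarith [hψN x hx])
    simpa [neg_div] using this
  · intro x hx
    have := div_le_div_of_nonneg_right (show -(s : ℝ) ≤ ψ x by linarith [hψN x hx]) hs'.le
    rw [neg_div, div_self hs'.ne'] at this
    linarith

theorem le_volume_bodyOver (hψ : ConcaveOn ℝ C ψ) {N : ℝ} (hψN : ∀ x ∈ C, -N ≤ ψ x)
    (hψ0 : ∀ x ∈ C, ψ x ≤ 0) (hs : 0 < s) (hN : 2 * N ≤ s) :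
    volume (Metric.closedBall (0 : E s) 1) * (ENNReal.ofReal (Real.exp (-(2 * N ^ 2 / s))) *
      ∫⁻ x in C, ENNReal.ofReal (Real.exp (ψ x))) ≤ volume (bodyOver s C ψ) := by
  have hs' : (0 : ℝ) < s := by exact_mod_cast hs
  rw [volume_bodyOver hψ]
  · gcongr 1
    rw [← lintegral_const_mul' _ _ ENNReal.ofReal_ne_top]
    refine lintegral_mono_ae ((ae_restrict_iff'₀ (hψ.1.nullMeasurableSet _)).2
      (Eventually.of_forall fun x hx => ?_))
    rw [← ENNReal.ofReal_mul (Real.exp_pos _).le]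
    refine ENNReal.ofReal_le_ofReal ?_
    have := exp_sub_le_one_sub_div_pow hs (z := -ψ x) (M := N)
      (by rw [abs_neg, abs_le]; exact ⟨hψN x hx, by linarith [hψ0 x hx, hψN x hx]⟩) hN
    simpa [neg_div] using this
  · intro x hx
    have := div_le_div_of_nonneg_right
      (show -(s : ℝ) ≤ ψ x by linarith [hψN x hx, hψ0 x hx]) hs'.le
    rw [neg_div, div_self hs'.ne'] at this
    linarith

end

section

variable {n s : ℕ} {C : Set (E n)} {ψ : E n → ℝ}

/-! ### The polar body -/

theorem volume_enorm_pow_lt (hs : 0 < s) {τ : ℝ≥0∞} (hτ : τ ≠ ∞) :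
    volume {v : E s | ‖v‖ₑ ^ s < τ} = volume (Metric.closedBall (0 : E s) 1) * τ := by
  have hne : τ ^ (s⁻¹ : ℝ) ≠ ∞ := by simp [hτ]
  have hpow : (τ ^ (s⁻¹ : ℝ)) ^ s = τ := ENNReal.rpow_inv_natCast_pow hs.ne' τ
  have hball : {v : E s | ‖v‖ₑ ^ s < τ} = Metric.ball 0 (τ ^ (s⁻¹ : ℝ)).toReal := by
    ext v
    rw [mem_ball_zero_iff, mem_ofPred_eq]
    conv_lhs => rw [← hpow]
    rw [(ENNReal.pow_right_strictMono hs.ne').lt_iff_lt, ← ofReal_norm,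
      ENNReal.ofReal_lt_iff_lt_toReal (norm_nonneg v) hne]
  have : Nonempty (Fin s) := ⟨⟨0, hs⟩⟩
  rw [hball, ← Measure.addHaar_closedBall_eq_addHaar_ball,
    volume_closedBall_eq ENNReal.toReal_nonneg, ENNReal.ofReal_toReal hne, hpow, mul_comm]

theorem lintegral_comp_natCast_smul (hs : 0 < s) {g : E n → ℝ≥0∞} (hg : Measurable g) :
    (s : ℝ≥0∞) ^ n * ∫⁻ u, g ((s : ℝ) • u) = ∫⁻ u, g u := by
  have hs' : (0 : ℝ) < s := by exact_mod_cast hs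
  rw [← lintegral_map hg (measurable_const_smul (s : ℝ)),
    Measure.map_addHaar_smul _ hs'.ne', lintegral_smul_measure, finrank_euclideanSpace,
    Fintype.card_fin, abs_of_nonneg (by positivity), ENNReal.ofReal_inv_of_pos (by positivity),
    ENNReal.ofReal_pow hs'.le, ENNReal.ofReal_natCast, smul_eq_mul, ← mul_assoc,
    ENNReal.mul_inv_cancel, one_mul]
  · simp [hs.ne']
  · exact ENNReal.pow_ne_top (ENNReal.natCast_ne_top s)

theorem volume_pow_lt_comp_smul (hs : 0 < s) {P : E n → ℝ≥0∞} (hP : Measurable P)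
    (hPt : ∀ u, P u ≠ ∞) {ε : ℝ≥0∞} (hε : ε ≠ ∞) (R : ℝ) :
    (s : ℝ≥0∞) ^ n * volume {w : E n × E s |
        (s : ℝ) • w.1 ∈ Metric.closedBall 0 R ∧ ‖w.2‖ₑ ^ s < ε * P ((s : ℝ) • w.1)} =
      volume (Metric.closedBall (0 : E s) 1) * (ε * ∫⁻ u in Metric.closedBall 0 R, P u) := by
  have hm : MeasurableSet {w : E n × E s |
      (s : ℝ) • w.1 ∈ Metric.closedBall 0 R ∧ ‖w.2‖ₑ ^ s < ε * P ((s : ℝ) • w.1)} := by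
    refine MeasurableSet.inter ?_ ?_
    · exact Metric.isClosed_closedBall.measurableSet.preimage (measurable_fst.const_smul (s : ℝ))
    · exact measurableSet_lt (f := fun w : E n × E s => ‖w.2‖ₑ ^ s)
        (g := fun w => ε * P ((s : ℝ) • w.1)) (by fun_prop) (by fun_prop)
  have hsec : ∀ u : E n, volume (Prod.mk u ⁻¹' {w : E n × E s |
      (s : ℝ) • w.1 ∈ Metric.closedBall 0 R ∧ ‖w.2‖ₑ ^ s < ε * P ((s : ℝ) • w.1)}) =
      volume (Metric.closedBall (0 : E s) 1) *
        (ε * (Metric.closedBall 0 R).indicator P ((s : ℝ) • u)) := by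
    intro u
    by_cases hu : (s : ℝ) • u ∈ Metric.closedBall 0 R
    · rw [indicator_of_mem hu, ← volume_enorm_pow_lt hs (ENNReal.mul_ne_top hε (hPt _))]
      congr 1
      ext v
      simp only [mem_preimage, mem_ofPred_eq, hu, true_and]
    · rw [indicator_of_notMem hu, mul_zero, mul_zero]
      convert! measure_empty (μ := (volume : Measure (E s)))
      ext v
      simp only [mem_preimage, mem_ofPred_eq, hu, false_and, mem_empty_iff_false]
  rw [Measure.volume_eq_prod, Measure.prod_apply hm]
  simp_rw [hsec]
  rw [lintegral_const_mul' _ _ (isCompact_closedBall _ _).measure_lt_top.ne,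
    lintegral_const_mul' _ _ hε, mul_left_comm, mul_left_comm _ ε,
    lintegral_comp_natCast_smul hs (hP.indicator Metric.isClosed_closedBall.measurableSet),
    lintegral_indicator Metric.isClosed_closedBall.measurableSet]

/-- If `P(u) ≤ e^{-⟨u, x - b⟩ - ψ(x)}` on `C`, then the polar of `bodyOver s C ψ` with respect to
`(b, 0)` contains the points `(u, v)` with `|s u| ≤ R` and `|v| ^ s < e^{-2M²/s} P(s u)`, where `M`
bounds the scalar products that occur. -/
theorem polar_bodyOver_of_pow_lt (hs : 0 < s) {N : ℝ} (hψN : ∀ x ∈ C, -N ≤ ψ x) (hN : N ≤ s)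
    {b : E n} {P : E n → ℝ≥0∞}
    (hP : ∀ u, ∀ x ∈ C, P u ≤ ENNReal.ofReal (Real.exp (-inner ℝ u (x - b) - ψ x)))
    {R M : ℝ} (hM : ∀ u ∈ Metric.closedBall (0 : E n) R, ∀ x ∈ C, |inner ℝ u (x - b)| ≤ M)
    (hMs : 2 * M ≤ s) {w : E n × E s} (hw : (s : ℝ) • w.1 ∈ Metric.closedBall 0 R)
    (hw2 : ‖w.2‖ₑ ^ s < ENNReal.ofReal (Real.exp (-(2 * M ^ 2 / s))) * P ((s : ℝ) • w.1))
    {z : E n × E s} (hz : z ∈ bodyOver s C ψ) :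
    inner ℝ w.1 (z.1 - b) + inner ℝ w.2 (z.2 - 0) ≤ 1 := by
  have hs' : (0 : ℝ) < s := by exact_mod_cast hs
  obtain ⟨hzC, hz2⟩ := hz
  set t : ℝ := inner ℝ ((s : ℝ) • w.1) (z.1 - b) with ht
  have htM : |t| ≤ M := hM _ hw _ hzC
  have htw : inner ℝ w.1 (z.1 - b) = t / s := by
    rw [ht, real_inner_smul_left]
    field_simp
  have h1 : ‖w.2‖ ^ s ≤ Real.exp (-(2 * M ^ 2 / s)) * Real.exp (-t - ψ z.1) := by
    have h := hw2.le.trans (mul_le_mul_right (hP _ _ hzC) _)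
    rw [← ofReal_norm, ← ENNReal.ofReal_pow (norm_nonneg _),
      ← ENNReal.ofReal_mul (Real.exp_pos _).le, ENNReal.ofReal_le_ofReal_iff (by positivity)] at h
    exact h
  have hr : 0 ≤ 1 + ψ z.1 / s := (norm_nonneg _).trans hz2
  have h2 : (1 + ψ z.1 / s) ^ s ≤ Real.exp (ψ z.1) := by
    have := Real.one_sub_div_pow_le_exp_neg (n := s) (t := -ψ z.1) (by linarith [hψN _ hzC])
    simpa [neg_div] using this
  have h3 := exp_sub_le_one_sub_div_pow hs htM hMs
  have h4 : 0 ≤ 1 - t / s := by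
    have : t / s ≤ 1 := by
      rw [div_le_one hs']
      have := (abs_le.1 htM).2
      have := (abs_nonneg t).trans htM
      linarith
    linarith
  have h5 : (‖w.2‖ * (1 + ψ z.1 / s)) ^ s ≤ (1 - t / s) ^ s := by
    calc (‖w.2‖ * (1 + ψ z.1 / s)) ^ s = ‖w.2‖ ^ s * (1 + ψ z.1 / s) ^ s := mul_pow _ _ _
      _ ≤ (Real.exp (-(2 * M ^ 2 / s)) * Real.exp (-t - ψ z.1)) * Real.exp (ψ z.1) := by
          gcongr
      _ = Real.exp (-(2 * M ^ 2 / s)) * Real.exp (-t) := by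
          rw [mul_assoc, ← Real.exp_add]
          ring_nf
      _ ≤ _ := h3
  have h6 := le_of_pow_le_pow_left₀ hs.ne' h4 h5
  have h7 : inner ℝ w.2 z.2 ≤ ‖w.2‖ * (1 + ψ z.1 / s) :=
    (real_inner_le_norm _ _).trans (by gcongr)
  rw [sub_zero, htw]
  linarith

end

/-! ### Functions with bounded logarithm on a bounded convex set -/

section

variable {n s : ℕ} {C : Set (E n)} {ψ : E n → ℝ}

theorem volume_closure_of_convex {A : Set (E n × E s)} (hA : Convex ℝ A) :
    volume (closure A) = volume A := by
  refine le_antisymm ?_ (measure_mono subset_closure)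
  have hfr : volume (frontier A) = 0 :=
    hA.addHaar_frontier ((volume : Measure (E n)).prod (volume : Measure (E s)))
  calc volume (closure A) ≤ volume (A ∪ frontier A) := by
        rw [closure_eq_self_union_frontier]
    _ ≤ volume A + volume (frontier A) := measure_union_le _ _
    _ = volume A := by rw [hfr, add_zero]

/-- If every half-space `{⟨b, θ⟩ ≤ ⟨x, θ⟩}` that misses the origin cuts off more than the fraction
`l < 1/2` of the volume of a symmetric body, and the body is also invariant under the reflection
in `ℝⁿ`, then `(b, 0)` lies in its floating body. -/
theorem inner_le_of_volume_cut {K : Set (E n × E s)} (hK : MeasurableSet K) (hconv : Convex ℝ K)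
    (h1 : ∀ x y, (x, y) ∈ K → (-x, y) ∈ K) (h2 : ∀ x y, (x, y) ∈ K → (x, -y) ∈ K)
    (hK0 : volume K ≠ 0) (hKt : volume K ≠ ∞) {l : ℝ} (hl : l < 1 / 2) {b : E n}
    (hb : ∀ θ : E n, 0 < inner ℝ b θ → ENNReal.ofReal l * volume K <
      volume (K ∩ {z | inner ℝ b θ ≤ inner ℝ z.1 θ}))
    (θ : E n) (η : E s) (α : ℝ)
    (hα : volume (K ∩ {z | α ≤ inner ℝ z.1 θ + inner ℝ z.2 η}) = ENNReal.ofReal l * volume K) :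
    inner ℝ b θ + inner ℝ (0 : E s) η ≤ α := by
  rw [inner_zero_left, add_zero]
  by_contra! hlt
  set A := K ∩ {z | α ≤ inner ℝ z.1 θ + inner ℝ z.2 η} with hA
  rcases le_or_gt (inner ℝ b θ) 0 with hc | hc
  · -- The half-space contains the origin, hence at least half of the volume of `K`.
    have hneg : ∀ z ∈ K, -z ∈ K := fun z hz => h2 _ _ (h1 _ _ hz)
    have hcover : K ⊆ A ∪ Neg.neg ⁻¹' A := by
      intro z hz
      rcases le_total 0 (inner ℝ z.1 θ + inner ℝ z.2 η) with h | h
      · exact Or.inl ⟨hz, by simp only [mem_ofPred_eq]; linarith⟩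
      · refine Or.inr ⟨hneg z hz, ?_⟩
        simp only [mem_ofPred_eq, Prod.fst_neg, Prod.snd_neg, inner_neg_left]
        linarith
    have hhalf : volume K ≤ 2 * volume A := by
      refine (measure_mono hcover).trans ((measure_union_le _ _).trans (le_of_eq ?_))
      have : volume (Neg.neg ⁻¹' A) = volume A :=
        ((Measure.measurePreserving_neg (volume : Measure (E n))).prod
          (Measure.measurePreserving_neg (volume : Measure (E s)))).measure_preimage_emb
          (MeasurableEquiv.neg (E n × E s)).measurableEmbedding A
      rw [this, two_mul]
    rw [hα, ← mul_assoc] at hhalf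
    have h2l : 2 * ENNReal.ofReal l < 1 := by
      rw [← ENNReal.ofReal_ofNat 2, ← ENNReal.ofReal_mul (by norm_num)]
      exact ENNReal.ofReal_lt_one.2 (by linarith)
    refine absurd hhalf (not_le.2 ?_)
    calc 2 * ENNReal.ofReal l * volume K < 1 * volume K := ENNReal.mul_lt_mul_left hK0 hKt h2l
      _ = volume K := one_mul _
  · have hθ : θ ≠ 0 := by
      rintro rfl
      simp at hc
    have hsec : ∀ y, Convex ℝ {x | (x, y) ∈ K} := by
      intro y x hx x' hx' p q hp hq hpq
      have := hconv hx hx' hp hq hpq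
      rwa [Prod.smul_mk, Prod.smul_mk, Prod.mk_add_mk, ← add_smul, hpq, one_smul] at this
    have h3 := volume_inter_upperHalfSpace_le_tilt hK hsec h1 h2 hθ η hc
    have h4 : volume (K ∩ {z | inner ℝ b θ ≤ inner ℝ z.1 θ + inner ℝ z.2 η}) ≤ volume A :=
      measure_mono fun z hz => ⟨hz.1, hlt.le.trans hz.2⟩
    exact absurd ((hb θ hc).trans_le (h3.trans (h4.trans_eq hα))) (lt_irrefl _)

theorem tendsto_ofReal_exp_neg_div (c : ℝ) :
    Tendsto (fun s : ℕ => ENNReal.ofReal (Real.exp (-(c / s)))) atTop (𝓝 1) := by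
  have h1 : Tendsto (fun s : ℕ => c / (s : ℝ)) atTop (𝓝 0) :=
    tendsto_const_div_atTop_nhds_zero_nat c
  have h2 := (ENNReal.continuous_ofReal.tendsto _).comp
    ((Real.continuous_exp.tendsto _).comp h1.neg)
  simpa [Function.comp_def] using h2

/-- The Santaló inequality for the function `exp ψ` on `C`, obtained from the inequality for the
bodies over `ψ` with fibres of dimension `s`, as `s` tends to infinity. The function `P` is a lower
bound for the polar of the translated function. -/
theorem lintegral_exp_mul_lintegral_le {l l' d : ℝ} (hl0 : 0 < l) (hl1 : l < 1 / 2) (hll' : l < l')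
    (hbody : ∀ (m : ℕ) (K : Set (E m)), IsConvexBody K → IsCentrallySymmetric K →
      bodyFloatingBody K l ⊆ bodySantaloRegion K d)
    (hCb : Bornology.IsBounded C) (hC0 : 0 ∈ interior C) (hCs : ∀ x ∈ C, -x ∈ C)
    (hψ : ConcaveOn ℝ C ψ) (hψe : ∀ x, ψ (-x) = ψ x) {N : ℝ} (hψN : ∀ x ∈ C, -N ≤ ψ x)
    (hψ0 : ∀ x ∈ C, ψ x ≤ 0) {b : E n}
    (hb : ∀ θ : E n, 0 < inner ℝ b θ →
      ENNReal.ofReal l' * ∫⁻ x in C, ENNReal.ofReal (Real.exp (ψ x)) ≤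
        ∫⁻ x in C ∩ upperHalfSpace θ (inner ℝ b θ), ENNReal.ofReal (Real.exp (ψ x)))
    {P : E n → ℝ≥0∞} (hPm : Measurable P)
    (hP : ∀ u, ∀ x ∈ C, P u ≤ ENNReal.ofReal (Real.exp (-inner ℝ u (x - b) - ψ x))) (R : ℝ) :
    (∫⁻ x in C, ENNReal.ofReal (Real.exp (ψ x))) * ∫⁻ u in Metric.closedBall 0 R, P u ≤
      ENNReal.ofReal ((2 * Real.pi) ^ n) * ENNReal.ofReal d := by
  set I : ℝ≥0∞ := ∫⁻ x in C, ENNReal.ofReal (Real.exp (ψ x)) with hI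
  set J : ℝ≥0∞ := ∫⁻ u in Metric.closedBall 0 R, P u with hJ
  have h0C : (0 : E n) ∈ C := interior_subset hC0
  have hPt : ∀ u, P u ≠ ∞ := fun u => ((hP u 0 h0C).trans_lt ENNReal.ofReal_lt_top).ne
  obtain ⟨ρ, hρ0, hρ⟩ : ∃ ρ : ℝ, 0 ≤ ρ ∧ ∀ x ∈ C, ‖x - b‖ ≤ ρ := by
    obtain ⟨r, hr0, hr⟩ := hCb.exists_pos_norm_le
    exact ⟨r + ‖b‖, by positivity, fun x hx => (norm_sub_le _ _).trans (by linarith [hr x hx])⟩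
  obtain ⟨M, hM⟩ : ∃ M : ℝ, ∀ u ∈ Metric.closedBall (0 : E n) R, ∀ x ∈ C,
      |inner ℝ u (x - b)| ≤ M := by
    refine ⟨R * ρ, fun u hu x hx => (abs_real_inner_le_norm _ _).trans ?_⟩
    rw [mem_closedBall_zero_iff] at hu
    exact mul_le_mul hu (hρ x hx) (norm_nonneg _) ((norm_nonneg _).trans hu)
  have hIpos : I ≠ 0 ∧ I ≠ ∞ := by
    constructor
    · have hCpos : 0 < volume C :=
        (Measure.measure_pos_of_mem_nhds volume (mem_interior_iff_mem_nhds.1 hC0))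
      intro h
      have : ENNReal.ofReal (Real.exp (-N)) * volume C ≤ I := by
        rw [← setLIntegral_const]
        exact lintegral_mono_ae ((ae_restrict_iff'₀ (hψ.1.nullMeasurableSet _)).2
          (Eventually.of_forall fun x hx =>
            ENNReal.ofReal_le_ofReal (Real.exp_le_exp.2 (hψN x hx))))
      rw [h, nonpos_iff_eq_zero, mul_eq_zero] at this
      rcases this with h | h
      · exact absurd h (by simp [Real.exp_pos])
      · exact hCpos.ne' h
    · have : I ≤ 1 * volume C := by
        rw [← setLIntegral_const]
        refine lintegral_mono_ae ((ae_restrict_iff'₀ (hψ.1.nullMeasurableSet _)).2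
          (Eventually.of_forall fun x hx => ?_))
        simpa using hψ0 x hx
      exact (this.trans_lt (by simpa using hCb.measure_lt_top)).ne
  set δ : ℕ → ℝ≥0∞ := fun s => ENNReal.ofReal (Real.exp (-(2 * N ^ 2 / s))) with hδ
  set ε : ℕ → ℝ≥0∞ := fun s => ENNReal.ofReal (Real.exp (-(2 * M ^ 2 / s))) with hε
  have hδ1 : Tendsto δ atTop (𝓝 1) := tendsto_ofReal_exp_neg_div _
  have hε1 : Tendsto ε atTop (𝓝 1) := tendsto_ofReal_exp_neg_div _
  have hlδ : ∀ᶠ s in atTop, ENNReal.ofReal l < δ s * ENNReal.ofReal l' := by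
    have : Tendsto (fun s => δ s * ENNReal.ofReal l') atTop (𝓝 (1 * ENNReal.ofReal l')) :=
      ENNReal.Tendsto.mul_const hδ1 (Or.inr ENNReal.ofReal_ne_top)
    refine this.eventually_const_lt ?_
    rw [one_mul]
    exact (ENNReal.ofReal_lt_ofReal_iff (hl0.trans hll')).2 hll'
  have hlarge : ∀ᶠ s : ℕ in atTop, max 1 (max (2 * N) (max (2 * M) (N + 1))) ≤ (s : ℝ) :=
    tendsto_natCast_atTop_atTop.eventually_ge_atTop _
  have hlim : Tendsto (fun s => ε s * δ s * (I * J)) atTop (𝓝 (1 * 1 * (I * J))) :=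
    ENNReal.Tendsto.mul_const (ENNReal.Tendsto.mul hε1 (Or.inl one_ne_zero) hδ1
      (Or.inl one_ne_zero)) (Or.inl (by simp))
  rw [one_mul, one_mul] at hlim
  refine le_of_tendsto hlim ?_
  filter_upwards [hlδ, hlarge] with s hlδ hlarge
  simp only [max_le_iff] at hlarge
  obtain ⟨hs1, hsN, hsM, hsN'⟩ := hlarge
  have hs : 0 < s := by exact_mod_cast zero_lt_one.trans_le hs1
  set κ := volume (Metric.closedBall (0 : E s) 1) with hκ
  have hκ0 : κ ≠ 0 := (Metric.measure_closedBall_pos volume _ one_pos).ne'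
  have hκt : κ ≠ ∞ := (isCompact_closedBall _ _).measure_lt_top.ne
  set K₀ := bodyOver s C ψ with hK₀
  have hK₀c : Convex ℝ K₀ := convex_bodyOver hψ
  -- `ψ` need not be upper semicontinuous, so compactness requires passing to the closure.
  have hvol : volume (closure K₀) = volume K₀ := volume_closure_of_convex hK₀c
  have hcomp : IsCompact (closure K₀) := (isBounded_bodyOver hCb hψ0).isCompact_closure
  have hint : 0 ∈ interior (closure K₀) := interior_mono subset_closure
    (zero_mem_interior_bodyOver hC0 hψN (by linarith) hs)
  have href1 : ∀ x y, (x, y) ∈ closure K₀ → (-x, y) ∈ closure K₀ := fun x y h =>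
    map_mem_closure (f := fun z : E n × E s => (-z.1, z.2)) (by fun_prop) h fun z hz =>
      ⟨hCs _ hz.1, by simpa only [hψe] using hz.2⟩
  have href2 : ∀ x y, (x, y) ∈ closure K₀ → (x, -y) ∈ closure K₀ := fun x y h =>
    map_mem_closure (f := fun z : E n × E s => (z.1, -z.2)) (by fun_prop) h fun z hz =>
      ⟨hz.1, by simpa only [norm_neg] using hz.2⟩
  have hK0 : volume (closure K₀) ≠ 0 :=
    (Measure.measure_pos_of_mem_nhds ((volume : Measure (E n)).prod (volume : Measure (E s)))
      (mem_interior_iff_mem_nhds.1 hint)).ne'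
  have hKt : volume (closure K₀) ≠ ∞ := hcomp.measure_lt_top.ne
  -- The point `(b, 0)` lies in the floating body.
  have hcut : ∀ θ : E n, 0 < inner ℝ b θ → ENNReal.ofReal l * volume (closure K₀) <
      volume (closure K₀ ∩ {z | inner ℝ b θ ≤ inner ℝ z.1 θ}) := by
    intro θ hθ
    have hU : Convex ℝ (upperHalfSpace θ (inner ℝ b θ)) := by
      refine convex_iff_forall_pos.2 fun x hx y hy p q hp hq hpq => ?_
      simp only [upperHalfSpace, mem_ofPred_eq, inner_add_left, real_inner_smul_left] at hx hy ⊢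
      obtain rfl : q = 1 - p := by linarith
      nlinarith
    have hψU : ConcaveOn ℝ (C ∩ upperHalfSpace θ (inner ℝ b θ)) ψ :=
      hψ.subset inter_subset_left (hψ.1.inter hU)
    have hsub : bodyOver s (C ∩ upperHalfSpace θ (inner ℝ b θ)) ψ ⊆
        closure K₀ ∩ {z | inner ℝ b θ ≤ inner ℝ z.1 θ} :=
      fun z hz => ⟨subset_closure ⟨hz.1.1, hz.2⟩, hz.1.2⟩
    calc ENNReal.ofReal l * volume (closure K₀)
        < δ s * ENNReal.ofReal l' * volume (closure K₀) := ENNReal.mul_lt_mul_left hK0 hKt hlδ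
      _ ≤ δ s * ENNReal.ofReal l' * (κ * I) := by
          rw [hvol]
          gcongr 1
          exact volume_bodyOver_le hψ hψN hs (by linarith)
      _ = κ * (δ s * (ENNReal.ofReal l' * I)) := by ring
      _ ≤ κ * (δ s * ∫⁻ x in C ∩ upperHalfSpace θ (inner ℝ b θ),
            ENNReal.ofReal (Real.exp (ψ x))) := by
          gcongr 2
          exact hb θ hθ
      _ ≤ volume (bodyOver s (C ∩ upperHalfSpace θ (inner ℝ b θ)) ψ) :=
          le_volume_bodyOver hψU (fun x hx => hψN x hx.1) (fun x hx => hψ0 x hx.1) hs hsN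
      _ ≤ _ := measure_mono hsub
  have hmain := volume_mul_volume_polar_le_of_prod (hbody (n + s)) hcomp hK₀c.closure hint
    (fun z hz => href2 _ _ (href1 _ _ hz)) (b, 0)
    (inner_le_of_volume_cut isClosed_closure.measurableSet hK₀c.closure href1 href2 hK0 hKt hl1
      hcut)
  -- The volume of the polar body is bounded below.
  have hpolar : {w : E n × E s | (s : ℝ) • w.1 ∈ Metric.closedBall 0 R ∧
      ‖w.2‖ₑ ^ s < ε s * P ((s : ℝ) • w.1)} ⊆
      {w | ∀ z ∈ closure K₀, inner ℝ w.1 (z.1 - b) + inner ℝ w.2 (z.2 - 0) ≤ 1} := by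
    rintro w ⟨hw1, hw2⟩
    refine fun z hz => closure_minimal (s := K₀) (t := {z : E n × E s |
      inner ℝ w.1 (z.1 - b) + inner ℝ w.2 (z.2 - 0) ≤ 1}) ?_ ?_ hz
    · exact fun z hz => polar_bodyOver_of_pow_lt hs hψN (by linarith) hP hM hsM hw1 hw2 hz
    · exact isClosed_le (by fun_prop) continuous_const
  have hQ := volume_pow_lt_comp_smul hs hPm hPt (ε := ε s) ENNReal.ofReal_ne_top R
  have hKvol : κ * (δ s * I) ≤ volume (closure K₀) := by
    rw [hvol]
    exact le_volume_bodyOver hψ hψN hψ0 hs hsN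
  have hfin : κ ^ 2 * (ε s * δ s * (I * J)) ≤
      κ ^ 2 * (ENNReal.ofReal ((2 * Real.pi) ^ n) * ENNReal.ofReal d) := by
    calc κ ^ 2 * (ε s * δ s * (I * J)) = (κ * (δ s * I)) * (κ * (ε s * J)) := by ring
      _ ≤ volume (closure K₀) * (κ * (ε s * J)) := by gcongr
      _ = (s : ℝ≥0∞) ^ n * (volume (closure K₀) * volume {w : E n × E s |
            (s : ℝ) • w.1 ∈ Metric.closedBall 0 R ∧ ‖w.2‖ₑ ^ s < ε s * P ((s : ℝ) • w.1)}) := by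
          rw [← hQ]
          ring
      _ ≤ (s : ℝ≥0∞) ^ n * (ENNReal.ofReal d *
            volume (Metric.closedBall (0 : E (n + s)) 1) ^ 2) := by
          gcongr 1
          refine le_trans ?_ hmain
          gcongr 1
          exact measure_mono hpolar
      _ = ENNReal.ofReal d * ((s : ℝ≥0∞) ^ n *
            volume (Metric.closedBall (0 : E (n + s)) 1) ^ 2) := by ring
      _ ≤ ENNReal.ofReal d * (ENNReal.ofReal (2 * Real.pi) ^ n * κ ^ 2) := by
          gcongr 1
          exact pow_mul_volume_closedBall_sq_le hs n
      _ = _ := by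
          rw [ENNReal.ofReal_pow (by positivity)]
          ring
  exact (ENNReal.mul_le_mul_iff_right (pow_ne_zero 2 hκ0) (ENNReal.pow_ne_top hκt)).1 hfin

end

section

variable {n : ℕ} {f : E n → ℝ≥0}

/-! ### The floating body of a log-concave function -/

theorem IsLogConcave.logConcave (hf : IsLogConcave f) : LogConcave fun x => (f x : ℝ≥0∞) := by
  intro x y p q hp hq hpq
  rw [← ENNReal.coe_rpow_of_nonneg _ hp.le, ← ENNReal.coe_rpow_of_nonneg _ hq.le,
    ← ENNReal.coe_mul]
  exact ENNReal.coe_le_coe.2 (hf x y p q hp hq hpq)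

theorem tendsto_lintegral_upperHalfSpace {F : E n → ℝ≥0∞} (hF : AEMeasurable F)
    (hfin : ∫⁻ x, F x ≠ ∞) (θ : E n) {u : Filter ℝ} [u.IsCountablyGenerated] {A : Set (E n)}
    (hA : MeasurableSet A) (h : ∀ᵐ x, ∀ᶠ c in u, (x ∈ upperHalfSpace θ c ↔ x ∈ A)) :
    Tendsto (fun c => ∫⁻ x in upperHalfSpace θ c, F x) u (𝓝 (∫⁻ x in A, F x)) := by
  have hmk : ∀ B : Set (E n), ∫⁻ x in B, F x = ∫⁻ x in B, hF.mk F x := fun B =>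
    lintegral_congr_ae (ae_restrict_of_ae hF.ae_eq_mk)
  simp_rw [hmk, ← lintegral_indicator hA]
  have : ∀ c, ∫⁻ x in upperHalfSpace θ c, hF.mk F x =
      ∫⁻ x, (upperHalfSpace θ c).indicator (hF.mk F) x := fun c =>
    (lintegral_indicator (measurableSet_upperHalfSpace θ c) _).symm
  simp_rw [this]
  refine tendsto_lintegral_filter_of_dominated_convergence (hF.mk F)
    (Eventually.of_forall fun c => hF.measurable_mk.indicator (measurableSet_upperHalfSpace θ c))
    (Eventually.of_forall fun c => Eventually.of_forall fun x => indicator_le_self _ _ x)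
    (by rwa [← lintegral_congr_ae hF.ae_eq_mk]) ?_
  filter_upwards [h] with x hx
  refine tendsto_const_nhds.congr' ?_
  filter_upwards [hx] with c hc
  by_cases hxA : x ∈ A
  · rw [indicator_of_mem hxA, indicator_of_mem (hc.2 hxA)]
  · rw [indicator_of_notMem hxA, indicator_of_notMem (mt hc.1 hxA)]

/-- Each level between `0` and `∫ F` is the integral of `F` over a half-space in direction `θ`. -/
theorem exists_lintegral_upperHalfSpace_eq {F : E n → ℝ≥0∞} (hF : AEMeasurable F)
    (hfin : ∫⁻ x, F x ≠ ∞) {θ : E n} (hθ : θ ≠ 0) {L : ℝ≥0∞} (hL0 : 0 < L)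
    (hL : L < ∫⁻ x, F x) : ∃ c, ∫⁻ x in upperHalfSpace θ c, F x = L := by
  have hcont : Continuous fun c => ∫⁻ x in upperHalfSpace θ c, F x := by
    refine continuous_iff_continuousAt.2 fun c₀ =>
      tendsto_lintegral_upperHalfSpace hF hfin θ (measurableSet_upperHalfSpace θ c₀) ?_
    have : ∀ᵐ x : E n, inner ℝ x θ ≠ c₀ := by
      rw [ae_iff]
      simpa using volume_hyperplane hθ c₀
    filter_upwards [this] with x hx
    rcases hx.lt_or_gt with h | h
    · filter_upwards [lt_mem_nhds h] with c hc
      exact iff_of_false (not_le.2 hc) (not_le.2 h)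
    · filter_upwards [gt_mem_nhds h] with c hc
      exact iff_of_true hc.le h.le
  have hbot : Tendsto (fun c => ∫⁻ x in upperHalfSpace θ c, F x) atBot (𝓝 (∫⁻ x, F x)) := by
    have := tendsto_lintegral_upperHalfSpace hF hfin θ (u := atBot) MeasurableSet.univ
      (Eventually.of_forall fun x => by
        filter_upwards [eventually_le_atBot (inner ℝ x θ)] with c hc
        simpa [upperHalfSpace] using hc)
    simpa using this
  have htop : Tendsto (fun c => ∫⁻ x in upperHalfSpace θ c, F x) atTop (𝓝 0) := by
    have := tendsto_lintegral_upperHalfSpace hF hfin θ (u := atTop) MeasurableSet.empty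
      (Eventually.of_forall fun x => by
        filter_upwards [eventually_gt_atTop (inner ℝ x θ)] with c hc
        simpa [upperHalfSpace] using hc)
    simpa using this
  exact mem_range_of_exists_le_of_exists_ge hcont
    ((htop.eventually_le_const hL0).exists) ((hbot.eventually_const_le hL).exists)

/-- A half-space whose boundary passes through a point of the floating body carries at least the
fraction `l` of the integral. -/
theorem le_lintegral_upperHalfSpace_of_mem_funFloatingBody {l : ℝ} (hl0 : 0 < l) (hl1 : l < 1)
    (hf : IsLogConcave f) (hpos : 0 < funIntegral f) (hfin : funIntegral f < ∞) {a : E n}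
    (ha : a ∈ funFloatingBody f l) {θ : E n} (hθ : θ ≠ 0) :
    ENNReal.ofReal l * funIntegral f ≤
      ∫⁻ x in upperHalfSpace θ (inner ℝ a θ), (f x : ℝ≥0∞) := by
  have hθ' : 0 < ‖θ‖ := norm_pos_iff.2 hθ
  have hae := hf.logConcave.aemeasurable (volume : Measure (E n))
  have hunit : ‖(‖θ‖⁻¹ • θ)‖ = 1 := by
    rw [norm_smul, norm_inv, norm_norm, inv_mul_cancel₀ hθ'.ne']
  have hlT : ENNReal.ofReal l * funIntegral f < funIntegral f := by
    calc ENNReal.ofReal l * funIntegral f < 1 * funIntegral f :=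
          ENNReal.mul_lt_mul_left hpos.ne' hfin.ne (ENNReal.ofReal_lt_one.2 hl1)
      _ = _ := one_mul _
  obtain ⟨c, hc⟩ := exists_lintegral_upperHalfSpace_eq hae hfin.ne
    (θ := ‖θ‖⁻¹ • θ) (by rw [← norm_pos_iff, hunit]; exact one_pos)
    (ENNReal.mul_pos (by simpa using hl0) hpos.ne') hlT
  have hac : inner ℝ a (‖θ‖⁻¹ • θ) ≤ c := ha _ hunit c hc
  rw [← hc]
  refine lintegral_mono_set fun x hx => ?_
  have hx' : inner ℝ a (‖θ‖⁻¹ • θ) ≤ inner ℝ x (‖θ‖⁻¹ • θ) := hac.trans hx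
  rw [real_inner_smul_right, real_inner_smul_right] at hx'
  exact le_of_mul_le_mul_left hx' (inv_pos.2 hθ')

/-- For `0 < t < 1`, half-spaces whose boundary passes through `t • a`, with `a` in the floating
body, carry a fraction of the integral larger than `l`, uniformly in the direction. This follows
from log-concavity along the half-spaces between the one through the origin and the one
through `a`. -/
theorem le_lintegral_upperHalfSpace_smul {l : ℝ} (hl0 : 0 < l) (hl1 : l < 1)
    (hf : IsLogConcave f) (heven : Function.Even f) (hpos : 0 < funIntegral f)
    (hfin : funIntegral f < ∞) {a : E n} (ha : a ∈ funFloatingBody f l) {t : ℝ} (ht0 : 0 < t)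
    (ht1 : t < 1) {θ : E n} (hθ : θ ≠ 0) :
    ENNReal.ofReal ((1 / 2) ^ (1 - t) * l ^ t) * funIntegral f ≤
      ∫⁻ x in upperHalfSpace θ (inner ℝ (t • a) θ), (f x : ℝ≥0∞) := by
  have hq : 0 < 1 - t := by linarith
  set T := funIntegral f with hT
  have h0 : ENNReal.ofReal (1 / 2) * T ≤ ∫⁻ x in upperHalfSpace θ 0, (f x : ℝ≥0∞) := by
    have h := lintegral_le_two_mul_lintegral_upperHalfSpace (F := fun x => (f x : ℝ≥0∞))
      (fun x => by rw [heven x]) θ le_rfl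
    calc ENNReal.ofReal (1 / 2) * T
        ≤ ENNReal.ofReal (1 / 2) * (2 * ∫⁻ x in upperHalfSpace θ 0, (f x : ℝ≥0∞)) := by
          gcongr
          exact h
      _ = _ := by
          have h2 : ENNReal.ofReal (1 / 2) * 2 = 1 := by
            rw [show (2 : ℝ≥0∞) = ENNReal.ofReal 2 by simp, ← ENNReal.ofReal_mul (by norm_num)]
            norm_num
          rw [← mul_assoc, h2, one_mul]
  have h1 := le_lintegral_upperHalfSpace_of_mem_funFloatingBody hl0 hl1 hf hpos hfin ha hθ
  have hlc := hf.logConcave.lintegral_upperHalfSpace θ 0 (inner ℝ a θ) (1 - t) t hq ht0 (by ring)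
  rw [smul_zero, zero_add, smul_eq_mul, ← real_inner_smul_left] at hlc
  refine le_trans ?_ hlc
  calc ENNReal.ofReal ((1 / 2) ^ (1 - t) * l ^ t) * T
      = (ENNReal.ofReal (1 / 2) * T) ^ (1 - t) * (ENNReal.ofReal l * T) ^ t := by
        rw [ENNReal.mul_rpow_of_nonneg _ _ hq.le, ENNReal.mul_rpow_of_nonneg _ _ ht0.le,
          ENNReal.ofReal_rpow_of_pos (by norm_num), ENNReal.ofReal_rpow_of_pos hl0,
          ENNReal.ofReal_mul (by positivity)]
        have : T = T ^ (1 - t) * T ^ t := by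
          rw [← ENNReal.rpow_add_of_nonneg _ _ hq.le ht0.le, sub_add_cancel, ENNReal.rpow_one]
        conv_lhs => rw [this]
        ring
    _ ≤ _ := by gcongr

theorem lt_half_rpow_mul_rpow {l t : ℝ} (hl0 : 0 < l) (hl1 : l < 1 / 2) (ht1 : t < 1) :
    l < (1 / 2) ^ (1 - t) * l ^ t := by
  calc l = l ^ (1 - t) * l ^ t := by
        rw [← Real.rpow_add hl0, sub_add_cancel, Real.rpow_one]
    _ < (1 / 2) ^ (1 - t) * l ^ t := by
        have := Real.rpow_pos_of_pos hl0 t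
        have := Real.rpow_lt_rpow hl0.le hl1 (show 0 < 1 - t by linarith)
        gcongr

/-! ### The polar function -/

theorem measurable_functionPolar (f : E n → ℝ≥0) : Measurable (functionPolar f) := by
  refine (upperSemicontinuous_iInf fun y => ?_).measurable
  by_cases hy : (f y : ℝ≥0∞) = 0
  · have : (fun x : E n => ENNReal.ofReal (Real.exp (-inner ℝ x y)) / (f y : ℝ≥0∞)) =
        fun _ => ∞ := by
      ext x
      rw [hy, ENNReal.div_zero]
      simp [Real.exp_pos]
    rw [this]
    exact upperSemicontinuous_const
  · refine Continuous.upperSemicontinuous ?_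
    exact (ENNReal.continuous_div_const _ hy).comp
      (ENNReal.continuous_ofReal.comp (by fun_prop))

/-- Translating a function multiplies its polar by an exponential. -/
theorem functionPolar_funTranslate (f : E n → ℝ≥0) (b x : E n) :
    functionPolar (funTranslate f b) x =
      ENNReal.ofReal (Real.exp (-inner ℝ x b)) * functionPolar f x := by
  unfold functionPolar funTranslate
  rw [ENNReal.mul_iInf_of_ne (by simp [Real.exp_pos]) ENNReal.ofReal_ne_top,
    ← (Equiv.addRight b).iInf_comp]
  refine iInf_congr fun y => ?_
  rw [Equiv.coe_addRight, add_sub_cancel_right, ← mul_div_assoc,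
    ← ENNReal.ofReal_mul (Real.exp_pos _).le, ← Real.exp_add, inner_add_right]
  congr 4
  ring

theorem functionPolar_funTranslate_neg_le (heven : Function.Even f) (b u x : E n) :
    functionPolar (funTranslate f b) (-u) ≤
      ENNReal.ofReal (Real.exp (-inner ℝ u (x - b))) / f x := by
  refine (iInf_le _ (b - x)).trans (le_of_eq ?_)
  have : funTranslate f b (b - x) = f x := by
    rw [funTranslate, sub_sub_cancel_left]
    exact heven x
  have h2 : -inner ℝ (-u) (b - x) = -inner ℝ u (x - b) := by
    rw [inner_neg_left, ← neg_sub x b, inner_neg_right, neg_neg]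
  rw [this, h2]

/-! ### Truncation -/

theorem tendsto_setLIntegral_of_monotone {G : E n → ℝ≥0∞} (hG : AEMeasurable G)
    {S : ℕ → Set (E n)} (hS : Monotone S) (hSm : ∀ N, NullMeasurableSet (S N))
    (hex : ∀ x, G x ≠ 0 → ∃ N, x ∈ S N) :
    Tendsto (fun N => ∫⁻ x in S N, G x) atTop (𝓝 (∫⁻ x, G x)) := by
  simp_rw [← lintegral_indicator₀ (hSm _)]
  refine lintegral_tendsto_of_tendsto_of_monotone (fun N => hG.indicator₀ (hSm N))
    (Eventually.of_forall fun x i j hij => indicator_le_indicator_of_subset (hS hij)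
      (fun _ => zero_le) x) (Eventually.of_forall fun x => ?_)
  by_cases hx : G x = 0
  · have : ∀ N, (S N).indicator G x = 0 := fun N => by
      by_cases h : x ∈ S N
      · rw [indicator_of_mem h, hx]
      · exact indicator_of_notMem h _
    simp [this, hx]
  · obtain ⟨N, hN⟩ := hex x hx
    refine tendsto_const_nhds.congr' ?_
    filter_upwards [eventually_ge_atTop N] with M hM
    rw [indicator_of_mem (hS hM hN)]

theorem apply_le_apply_zero (hf : IsLogConcave f) (heven : Function.Even f) (x : E n) :
    f x ≤ f 0 := by
  have h := hf x (-x) (1 / 2) (1 / 2) (by norm_num) (by norm_num) (by norm_num)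
  rw [heven x, ← NNReal.rpow_add_of_nonneg _ (by norm_num) (by norm_num)] at h
  norm_num at h
  exact h

/-- The points of the ball of radius `N` where `f` is at least `e^{-N}` times its maximum. -/
def truncationSet (f : E n → ℝ≥0) (N : ℕ) : Set (E n) :=
  {x | Real.exp (-N) * f 0 ≤ f x} ∩ Metric.closedBall 0 N

theorem convex_truncationSet (hf : IsLogConcave f) (N : ℕ) : Convex ℝ (truncationSet f N) := by
  refine Convex.inter ?_ (convex_closedBall _ _)
  convert! hf.logConcave.convex_le (ENNReal.ofReal (Real.exp (-N) * f 0)) using 1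
  ext x
  rw [mem_ofPred_eq, mem_ofPred_eq, ← ENNReal.ofReal_coe_nnreal,
    ENNReal.ofReal_le_ofReal_iff (f x).coe_nonneg]

theorem monotone_truncationSet : Monotone (truncationSet f) := by
  intro N M hNM
  have : (N : ℝ) ≤ M := by exact_mod_cast hNM
  refine inter_subset_inter (fun x hx => ?_) (Metric.closedBall_subset_closedBall this)
  refine le_trans ?_ (show Real.exp (-N) * f 0 ≤ f x from hx)
  gcongr

theorem exists_mem_truncationSet {x : E n} (hx : f x ≠ 0) : ∃ N, x ∈ truncationSet f N := by
  have hlim : Tendsto (fun N : ℕ => Real.exp (-N) * f 0) atTop (𝓝 (0 * f 0)) :=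
    ((Real.tendsto_exp_neg_atTop_nhds_zero.comp tendsto_natCast_atTop_atTop)).mul_const _
  rw [zero_mul] at hlim
  have h1 := hlim.eventually_le_const (show (0 : ℝ) < f x from NNReal.coe_pos.2 hx.bot_lt)
  have h2 : ∀ᶠ N : ℕ in atTop, ‖x‖ ≤ N := tendsto_natCast_atTop_atTop.eventually_ge_atTop _
  obtain ⟨N, h1, h2⟩ := (h1.and h2).exists
  exact ⟨N, h1, by simpa using h2⟩

theorem neg_mem_truncationSet (heven : Function.Even f) {N : ℕ} {x : E n}
    (hx : x ∈ truncationSet f N) : -x ∈ truncationSet f N := by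
  refine ⟨?_, by simpa using hx.2⟩
  have := hx.1
  rwa [mem_ofPred_eq, ← heven x] at this

theorem zero_mem_interior_of_symmetric {C : Set (E n)} (hC : Convex ℝ C)
    (hCs : ∀ x ∈ C, -x ∈ C) (hvol : volume C ≠ 0) : 0 ∈ interior C := by
  obtain ⟨x, hx⟩ : (interior C).Nonempty := by
    by_contra h
    rw [not_nonempty_iff_eq_empty] at h
    refine hvol (measure_mono_null (fun x hx => ?_) (hC.addHaar_frontier volume))
    rw [frontier, h, sdiff_empty]
    exact subset_closure hx
  have hneg : -x ∈ interior C := by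
    have hpre : Neg.neg ⁻¹' C = C := by
      ext y
      exact ⟨fun h => by simpa using hCs _ h, hCs y⟩
    have := (Homeomorph.neg (E n)).preimage_interior C
    rw [Homeomorph.coe_neg, hpre] at this
    rw [← this] at hx
    exact hx
  have := hC.interior hx hneg (show (0 : ℝ) ≤ 1 / 2 by norm_num)
    (show (0 : ℝ) ≤ 1 / 2 by norm_num) (by norm_num)
  simpa using this

end

section

variable {n : ℕ} {f : E n → ℝ≥0}

/-! ### The Santaló region of a log-concave function -/

theorem concaveOn_log_div (hf : IsLogConcave f) {C : Set (E n)} (hC : Convex ℝ C)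
    (hpos : ∀ x ∈ C, 0 < f x) (h0 : 0 < f 0) :
    ConcaveOn ℝ C fun x => Real.log (f x / f 0) := by
  refine ⟨hC, fun x hx y hy p q hp hq hpq => ?_⟩
  rcases hp.eq_or_lt with rfl | hp
  · obtain rfl : q = 1 := by linarith
    simp
  rcases hq.eq_or_lt with rfl | hq
  · obtain rfl : p = 1 := by linarith
    simp
  have hx' : (0 : ℝ) < f x := hpos x hx
  have hy' : (0 : ℝ) < f y := hpos y hy
  have h0' : (0 : ℝ) < f 0 := h0
  have hxy : (0 : ℝ) < f (p • x + q • y) := hpos _ (hC hx hy hp.le hq.le hpq)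
  have h := NNReal.coe_le_coe.2 (hf x y p q hp hq hpq)
  rw [NNReal.coe_mul, NNReal.coe_rpow, NNReal.coe_rpow] at h
  have h := Real.log_le_log (by positivity) h
  rw [Real.log_mul (by positivity) (by positivity), Real.log_rpow hx', Real.log_rpow hy'] at h
  simp only [smul_eq_mul]
  rw [Real.log_div hx'.ne' h0'.ne', Real.log_div hy'.ne' h0'.ne', Real.log_div hxy.ne' h0'.ne']
  obtain rfl : q = 1 - p := by linarith
  linarith

/-- The Santaló inequality at `b`, truncated: the function is restricted to a level of
`truncationSet`, and its polar to a ball. -/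
theorem setLIntegral_truncationSet_mul_le {l l' d : ℝ} (hl0 : 0 < l) (hl1 : l < 1 / 2)
    (hll' : l < l')
    (hbody : ∀ (m : ℕ) (K : Set (E m)), IsConvexBody K → IsCentrallySymmetric K →
      bodyFloatingBody K l ⊆ bodySantaloRegion K d)
    (hf : IsLogConcave f) (heven : Function.Even f) (h0 : 0 < f 0) {N : ℕ}
    (hN : volume (truncationSet f N) ≠ 0) {b : E n}
    (hb : ∀ θ : E n, 0 < inner ℝ b θ →
      ENNReal.ofReal l' * ∫⁻ x in truncationSet f N, (f x : ℝ≥0∞) ≤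
        ∫⁻ x in truncationSet f N ∩ upperHalfSpace θ (inner ℝ b θ), (f x : ℝ≥0∞)) (R : ℝ) :
    (∫⁻ x in truncationSet f N, (f x : ℝ≥0∞)) *
        ∫⁻ u in Metric.closedBall 0 R, functionPolar (funTranslate f b) (-u) ≤
      ENNReal.ofReal ((2 * Real.pi) ^ n) * ENNReal.ofReal d := by
  set C := truncationSet f N with hCdef
  have h0' : (0 : ℝ) < f 0 := h0
  have hf0 : (f 0 : ℝ≥0∞) ≠ 0 := by simpa using h0.ne'
  have hC : Convex ℝ C := convex_truncationSet hf N
  have hpos : ∀ x ∈ C, 0 < f x := fun x hx =>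
    NNReal.coe_pos.1 (lt_of_lt_of_le (by positivity) hx.1)
  set ψ : E n → ℝ := fun x => Real.log (f x / f 0) with hψdef
  have hexp : ∀ x ∈ C, ENNReal.ofReal (Real.exp (ψ x)) = (f 0 : ℝ≥0∞)⁻¹ * f x := by
    intro x hx
    have hx' : (0 : ℝ) < f x := hpos x hx
    rw [hψdef]
    simp only
    rw [Real.exp_log (by positivity), ENNReal.ofReal_div_of_pos h0', ENNReal.ofReal_coe_nnreal,
      ENNReal.ofReal_coe_nnreal, ENNReal.div_eq_inv_mul]
  have hint : ∀ S ⊆ C, NullMeasurableSet S → ∫⁻ x in S, ENNReal.ofReal (Real.exp (ψ x)) =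
      (f 0 : ℝ≥0∞)⁻¹ * ∫⁻ x in S, (f x : ℝ≥0∞) := by
    intro S hS hSm
    rw [← lintegral_const_mul' _ _ (ENNReal.inv_ne_top.2 hf0)]
    exact lintegral_congr_ae ((ae_restrict_iff'₀ hSm).2
      (Eventually.of_forall fun x hx => hexp x (hS hx)))
  have hCm : NullMeasurableSet C := hC.nullMeasurableSet volume
  have key := lintegral_exp_mul_lintegral_le hl0 hl1 hll' hbody
    (C := C) (ψ := ψ) (N := N) (b := b)
    (P := fun u => (f 0 : ℝ≥0∞) * functionPolar (funTranslate f b) (-u))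
    (Metric.isBounded_closedBall.subset inter_subset_right)
    (zero_mem_interior_of_symmetric hC (fun x hx => neg_mem_truncationSet heven hx) hN)
    (fun x hx => neg_mem_truncationSet heven hx) (concaveOn_log_div hf hC hpos h0)
    (fun x => by simp only [hψdef, heven x])
    (fun x hx => by
      rw [hψdef]
      refine (Real.le_log_iff_exp_le (div_pos (hpos x hx) h0')).2 ?_
      rw [le_div_iff₀ h0']
      exact hx.1)
    (fun x hx => by
      refine Real.log_nonpos (by positivity) ?_
      rw [div_le_one h0']
      exact apply_le_apply_zero hf heven x)
    (fun θ hθ => by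
      rw [hint C subset_rfl hCm, hint _ inter_subset_left
        (hCm.inter (measurableSet_upperHalfSpace _ _).nullMeasurableSet), mul_left_comm]
      gcongr 1
      exact hb θ hθ)
    (((measurable_functionPolar _).comp measurable_neg).const_mul _)
    (fun u x hx => by
      have hx' : (0 : ℝ) < f x := hpos x hx
      calc (f 0 : ℝ≥0∞) * functionPolar (funTranslate f b) (-u)
          ≤ f 0 * (ENNReal.ofReal (Real.exp (-inner ℝ u (x - b))) / f x) := by
            gcongr 1
            exact functionPolar_funTranslate_neg_le heven b u x
        _ = ENNReal.ofReal (Real.exp (-inner ℝ u (x - b) - ψ x)) := by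
            rw [← ENNReal.ofReal_coe_nnreal (p := f x), ← ENNReal.ofReal_coe_nnreal (p := f 0),
              ← ENNReal.ofReal_div_of_pos hx', ← ENNReal.ofReal_mul (f 0).coe_nonneg,
              Real.exp_sub, hψdef]
            simp only
            rw [Real.exp_log (by positivity)]
            congr 1
            field_simp)
    R
  rw [hint C subset_rfl hCm, lintegral_const_mul' _ _ ENNReal.coe_ne_top] at key
  refine le_trans (le_of_eq ?_) key
  rw [mul_mul_mul_comm, ENNReal.inv_mul_cancel hf0 ENNReal.coe_ne_top, one_mul]

/-- The Santaló inequality at the points `t • a`, with `a` in the floating body and `0 < t < 1`. -/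
theorem funIntegral_mul_lintegral_polar_smul_le {l d : ℝ} (hl0 : 0 < l) (hl1 : l < 1 / 2)
    (hbody : ∀ (m : ℕ) (K : Set (E m)), IsConvexBody K → IsCentrallySymmetric K →
      bodyFloatingBody K l ⊆ bodySantaloRegion K d)
    (hf : IsLogConcave f) (heven : Function.Even f) (hpos : 0 < funIntegral f)
    (hfin : funIntegral f < ∞) {a : E n} (ha : a ∈ funFloatingBody f l) {t : ℝ} (ht0 : 0 < t)
    (ht1 : t < 1) :
    funIntegral f * ∫⁻ u, functionPolar (funTranslate f (t • a)) u ≤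
      ENNReal.ofReal ((2 * Real.pi) ^ n) * ENNReal.ofReal d := by
  set T := funIntegral f with hT
  have hae := hf.logConcave.aemeasurable (volume : Measure (E n))
  have h0 : 0 < f 0 := by
    by_contra! h
    have : ∀ x, f x = 0 := fun x =>
      le_antisymm ((apply_le_apply_zero hf heven x).trans h) (zero_le)
    refine hpos.ne' ?_
    simp [hT, funIntegral, this]
  set l₂ : ℝ := (1 / 2) ^ (1 - t) * l ^ t with hl₂
  have hll₂ : l < l₂ := lt_half_rpow_mul_rpow hl0 hl1 ht1
  set l' : ℝ := (l + l₂) / 2 with hl'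
  have hll' : l < l' := by linarith
  have hl'l₂ : l' < l₂ := by linarith
  have hCm : ∀ N, NullMeasurableSet (truncationSet f N) := fun N =>
    (convex_truncationSet hf N).nullMeasurableSet volume
  have hlimC : Tendsto (fun N => ∫⁻ x in truncationSet f N, (f x : ℝ≥0∞)) atTop (𝓝 T) :=
    tendsto_setLIntegral_of_monotone hae monotone_truncationSet hCm
      fun x hx => exists_mem_truncationSet (by simpa using hx)
  have hlimP : Tendsto (fun N : ℕ => ∫⁻ u in Metric.closedBall (0 : E n) N,
      functionPolar (funTranslate f (t • a)) (-u)) atTop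
      (𝓝 (∫⁻ u, functionPolar (funTranslate f (t • a)) (-u))) := by
    refine tendsto_setLIntegral_of_monotone
      ((measurable_functionPolar _).comp measurable_neg).aemeasurable
      (fun N M h => Metric.closedBall_subset_closedBall (by exact_mod_cast h))
      (fun N => Metric.isClosed_closedBall.measurableSet.nullMeasurableSet) fun x _ => ?_
    obtain ⟨N, hN⟩ := exists_nat_ge ‖x‖
    exact ⟨N, by simpa using hN⟩
  rw [lintegral_comp_neg (functionPolar (funTranslate f (t • a)))] at hlimP
  refine le_of_tendsto (ENNReal.Tendsto.mul hlimC (Or.inl hpos.ne') hlimP (Or.inr hfin.ne)) ?_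
  have hev1 := hlimC.eventually_ne hpos.ne'
  -- The mass outside the truncation set is eventually less than `(l₂ - l') T`.
  have hev2 : ∀ᶠ N in atTop, T < (∫⁻ x in truncationSet f N, (f x : ℝ≥0∞)) +
      ENNReal.ofReal (l₂ - l') * T := by
    refine (hlimC.add_const _).eventually_const_lt ?_
    refine ENNReal.lt_add_right hfin.ne (mul_ne_zero ?_ hpos.ne')
    simpa using hl'l₂
  filter_upwards [hev1, hev2] with N hN1 hN2
  refine setLIntegral_truncationSet_mul_le hl0 hl1 hll' hbody hf heven h0 (fun h => hN1 ?_)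
    (fun θ hθ => ?_) N
  · rw [Measure.restrict_eq_zero.2 h, lintegral_zero_measure]
  · have hθ0 : θ ≠ 0 := by
      rintro rfl
      simp at hθ
    set U := upperHalfSpace θ (inner ℝ (t • a) θ) with hU
    set C := truncationSet f N with hC
    have htail : ENNReal.ofReal l₂ * T ≤ ∫⁻ x in U, (f x : ℝ≥0∞) :=
      le_lintegral_upperHalfSpace_smul hl0 (by linarith) hf heven hpos hfin ha ht0 ht1 hθ0
    have hsplit : (∫⁻ x in C, (f x : ℝ≥0∞)) + ∫⁻ x in Cᶜ, (f x : ℝ≥0∞) = T := by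
        have h := Measure.restrict_inter_add_sdiff₀ (μ := (volume : Measure (E n))) univ (hCm N)
        rw [univ_inter, ← compl_eq_univ_sdiff, Measure.restrict_univ] at h
        rw [← lintegral_add_measure, h]
        rfl
    have hCfin : ∫⁻ x in C, (f x : ℝ≥0∞) ≠ ∞ :=
      ((setLIntegral_le_lintegral _ _).trans_lt hfin).ne
    have hcompl : ∫⁻ x in Cᶜ, (f x : ℝ≥0∞) ≤ ENNReal.ofReal (l₂ - l') * T := by
      rw [← hsplit] at hN2
      rw [← hsplit]
      exact (lt_of_add_lt_add_left hN2).le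
    have hUC : ∫⁻ x in U, (f x : ℝ≥0∞) ≤
        (∫⁻ x in C ∩ U, (f x : ℝ≥0∞)) + ∫⁻ x in Cᶜ, (f x : ℝ≥0∞) := by
      refine (lintegral_mono_set fun x hx => ?_).trans (lintegral_union_le _ _ _)
      by_cases hxC : x ∈ C
      · exact Or.inl ⟨hxC, hx⟩
      · exact Or.inr hxC
    have hsum : ENNReal.ofReal l' * T + ENNReal.ofReal (l₂ - l') * T ≤
        (∫⁻ x in C ∩ U, (f x : ℝ≥0∞)) + ENNReal.ofReal (l₂ - l') * T := by
      rw [← add_mul, ← ENNReal.ofReal_add (by linarith) (by linarith), add_sub_cancel]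
      exact htail.trans (hUC.trans (by gcongr))
    have := (ENNReal.add_le_add_iff_right
      (ENNReal.mul_ne_top ENNReal.ofReal_ne_top hfin.ne)).1 hsum
    refine le_trans ?_ this
    gcongr
    exact setLIntegral_le_lintegral _ _

end

end FloatingSantalo

theorem mainTheorem1 (l d : ℝ) (hl0 : 0 < l) (hl1 : l < 1 / 2) (hd : 0 < d)
    (hbody : ∀ (m : ℕ) (K : Set (FloatingSantalo.E m)),
      FloatingSantalo.IsConvexBody K → FloatingSantalo.IsCentrallySymmetric K →
        FloatingSantalo.bodyFloatingBody K l ⊆ FloatingSantalo.bodySantaloRegion K d)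
    (n : ℕ) (f : FloatingSantalo.E n → NNReal)
    (hlc : FloatingSantalo.IsLogConcave f) (heven : Function.Even f)
    (hpos : 0 < FloatingSantalo.funIntegral f) (hfin : FloatingSantalo.funIntegral f < ⊤) :
    FloatingSantalo.funFloatingBody f l ⊆ FloatingSantalo.funSantaloRegion f d := by
  open FloatingSantalo Filter Topology in
  intro a ha
  set D : ℝ≥0∞ := ENNReal.ofReal ((2 * Real.pi) ^ n) * ENNReal.ofReal d with hD
  have hD' : ENNReal.ofReal ((2 * Real.pi) ^ n * d) = D := ENNReal.ofReal_mul (by positivity)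
  have htrans : funIntegral (funTranslate f a) = funIntegral f :=
    lintegral_sub_right_eq_self (fun x => (f x : ℝ≥0∞)) a
  change funIntegral (funTranslate f a) * ∫⁻ x, functionPolar (funTranslate f a) x ≤ _
  rw [htrans, hD', mul_comm, ← ENNReal.le_div_iff_mul_le (Or.inl hpos.ne') (Or.inl hfin.ne)]
  -- The polar of `f_{t • a}` at a point depends continuously on `t`, so Fatou's lemma applies.
  let t : ℕ → ℝ := fun k => 1 - 1 / ((k : ℝ) + 2)
  have ht : Tendsto t atTop (𝓝 1) := by
    have h := (tendsto_const_div_atTop_nhds_zero_nat (1 : ℝ)).comp (tendsto_add_atTop_nat 2)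
    have h' := h.const_sub (1 : ℝ)
    simpa [t, Function.comp_def] using h'
  have ht0 : ∀ k, 0 < t k := fun k => by
    have hk : (0 : ℝ) ≤ k := k.cast_nonneg
    simp only [t, sub_pos]
    rw [div_lt_one (by positivity)]
    linarith
  have ht1 : ∀ k, t k < 1 := fun k => by
    have hk : (0 : ℝ) ≤ k := k.cast_nonneg
    simp only [t, sub_lt_self_iff]
    positivity
  have hpt : ∀ u, Tendsto (fun k => functionPolar (funTranslate f (t k • a)) u) atTop
      (𝓝 (functionPolar (funTranslate f a) u)) := by
    intro u
    simp_rw [functionPolar_funTranslate]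
    refine ENNReal.Tendsto.mul_const ?_ (Or.inl (by simp [Real.exp_pos]))
    refine (ENNReal.continuous_ofReal.tendsto _).comp ((Real.continuous_exp.tendsto _).comp ?_)
    have hlim := ((ht.smul_const a).inner (𝕜 := ℝ) (tendsto_const_nhds (x := u))).neg
    simpa [real_inner_comm] using hlim
  calc ∫⁻ u, functionPolar (funTranslate f a) u
      = ∫⁻ u, liminf (fun k => functionPolar (funTranslate f (t k • a)) u) atTop :=
        lintegral_congr fun u => (hpt u).liminf_eq.symm
    _ ≤ liminf (fun k => ∫⁻ u, functionPolar (funTranslate f (t k • a)) u) atTop :=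
        lintegral_liminf_le fun k => measurable_functionPolar _
    _ ≤ liminf (fun _ : ℕ => D / funIntegral f) atTop := by
        refine liminf_le_liminf (Eventually.of_forall fun k => ?_)
        rw [ENNReal.le_div_iff_mul_le (Or.inl hpos.ne') (Or.inl hfin.ne), mul_comm]
        exact funIntegral_mul_lintegral_polar_smul_le hl0 hl1 hbody hlc heven hpos hfin ha
          (ht0 k) (ht1 k)
    _ = D / funIntegral f := liminf_const _
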